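/- Let $G=(V,E)$ be a finite planar graph with node weights $w_v\ge 0$ and penalties $\pi_{ij}\ge 0$ for the pairs $(i,j)\in V\times V$, such that $\pi_{ij}>0$ implies $w_i=w_j=0$. The pairs with $\pi_{ij}>0$ are called demands. A pair $(i,j)$ is connected via $F\subseteq V$ if $i,j\in F$ lie in the same component of the induced subgraph $G[F]$. Let $OPT$ be the minimum over all $F\subseteq V$ of $\sum_{v\in F}w_v$ plus the total penalty of the demands not connected via $F$ (node-weighted prize-collecting Steiner forest). For $S\subseteq V$ let $\Gamma(S)$ be the set of vertices outside $S$ with a neighbour in $S$. A set $S$ separates $(i,j)$ if it contains exactly one of $i,j$, and a family $\mathbb S$ of vertex sets separates $(i,j)$ if one of its members does. Consider the linear program of maximizing $\sum_{S\subseteq V}y_S$ over $y\ge 0$ subject to $$\sum_{S:\,v\in\Gamma(S)}y_S\le w_v\quad(v\in V),\qquad \sum_{S\in\mathbb S}y_S\le\sum_{(i,j)\text{ separated by }\mathbb S}\pi_{ij}\quad(\mathbb S\subseteq 2^V).$$ A vertex, respectively a family, is tight if its constraint holds with equality. The primal-dual algorithm starts with $F=\{v: w_v=0\}$, no marked pair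 ($Q=\emptyset$) and $y=0$. A component $S$ of $G[F]$ is active if it separates a demand outside $Q$. While there is an active component, let $\varepsilon_1\ge0$ (respectively $\varepsilon_2\ge 0$) be the minimum amount such that raising $y_S$ by this amount for all active $S$ yields a tight vertex outside $F$ (respectively a tight family that separates a demand outside $Q$), where a minimum over the empty set is $\infty$. Raise $y_S$ for all active $S$ by $\min(\varepsilon_1,\varepsilon_2)$. If $\varepsilon_1\le\varepsilon_2$, add such a tight vertex to $F$; otherwise add all pairs separated by such a tight family to $Q$. When no component is active, consider the vertices of $F$ in the reverse order of purchase (the vertices of weight $0$ were bought first, in any order), and delete a vertex if afterwards all demands outside $Q$ are still connected via the remaining set. The output is the remaining set $F'$ and the set $Q'$ of all demands not connected via $F'$. Then, for every choice of tight vertices, tight families and the initial order, the algorithm never gets stuck and terminates, the final $y$ is feasible for the linear program, and $$\sum_{v\in F'}w_v+\sum_{(i,j)\in Q'}\pi_{ij}\le 4\sum_{S\subseteq V}y_S\le 4\,OPT;$$ more precisely $\sum_{(i,j)\in Q'}\pi_{ij}\le\sum_{S\subseteq V}y_S$ and $\sum_{v\in F'}w_v\le 3\sum_{S\subseteq V}y_S$.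 -/

import Mathlib

/-! ### Planar graphs -/

section Planarity

variable {V : Type*}

/-- The involution that reverses every dart (oriented edge) of `G`. -/
def dartReversal (G : SimpleGraph V) : Equiv.Perm G.Dart :=
  SimpleGraph.Dart.symm_involutive.toPerm

/-- A rotation system (combinatorial embedding) of `G`: a permutation of the darts that cyclically
permutes, for every vertex `v`, the darts with tail `v`. -/
def IsRotationSystem (G : SimpleGraph V) (σ : Equiv.Perm G.Dart) : Prop :=
  ∀ d e : G.Dart, σ.SameCycle d e ↔ d.fst = e.fst

/-- The facial walks of a rotation system: the cycles of "reverse the dart, then rotate". -/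
def RotationFaces (G : SimpleGraph V) (σ : Equiv.Perm G.Dart) : Type _ :=
  Quotient (Equiv.Perm.SameCycle.setoid (σ * dartReversal G))

/-- A finite graph is planar if it has a rotation system of genus zero, that is, one for which
Euler's formula `#vertices - #edges + #faces = 2` holds on every connected component, each drawn
on a sphere of its own. The left side minus the right side is never positive on a component, so it
suffices to require the sum of these equations over all components. An isolated vertex has no darts
and so no facial walk, but it has one face; these faces are counted separately. -/
def IsPlanarGraph [Finite V] (G : SimpleGraph V) : Prop :=
  ∃ σ : Equiv.Perm G.Dart, IsRotationSystem G σ ∧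
    Nat.card V + (Nat.card (RotationFaces G σ) + Nat.card {v : V // ∀ u, ¬ G.Adj v u}) =
      Nat.card G.edgeSet + 2 * Nat.card G.ConnectedComponent

end Planarity

/-! ### Node-weighted prize-collecting Steiner forest -/

/-- An instance of the problem: a graph, non-negative node weights, and a non-negative penalty for
every pair of vertices. The demands are the pairs with a positive penalty. -/
structure PCSF (V : Type*) where
  G : SimpleGraph V
  w : V → ℝ
  pen : V × V → ℝ
  w_nonneg : ∀ v, 0 ≤ w v
  pen_nonneg : ∀ p, 0 ≤ pen p

/-- A state of the growth phase of the primal-dual algorithm. -/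
structure PCSFState (V : Type*) where
  /-- the vertices bought so far, the most recently bought one first -/
  bought : List V
  /-- the set `Q` of marked pairs -/
  marked : Finset (V × V)
  /-- the dual variables `y_S` -/
  y : Finset V → ℝ

namespace PCSF

/-- `S ⊙ (i, j)`: exactly one of `i`, `j` lies in `S`. -/
def Separates {V : Type*} (S : Finset V) (p : V × V) : Prop :=
  (p.1 ∈ S ∧ p.2 ∉ S) ∨ (p.1 ∉ S ∧ p.2 ∈ S)

/-- A family separates a pair if one of its members does. -/
def FamilySeparates {V : Type*} (𝕊 : Finset (Finset V)) (p : V × V) : Prop :=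
  ∃ S ∈ 𝕊, Separates S p

variable {V : Type*} [Fintype V] (I : PCSF V)

/-- `(i, j)` is a demand. -/
def IsDemand (p : V × V) : Prop := 0 < I.pen p

/-- The two vertices of the pair belong to `F` and are connected in the induced subgraph `G[F]`. -/
def ConnectedVia (F : Finset V) (p : V × V) : Prop :=
  ∃ (h₁ : p.1 ∈ F) (h₂ : p.2 ∈ F),
    (I.G.induce (F : Set V)).Reachable ⟨p.1, h₁⟩ ⟨p.2, h₂⟩

open scoped Classical in
/-- The demands that are not connected via `F`. -/
noncomputable def unconnected (F : Finset V) : Finset (V × V) :=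
  Finset.univ.filter fun p => I.IsDemand p ∧ ¬ I.ConnectedVia F p

/-- The objective value of a vertex set `F`. -/
noncomputable def cost (F : Finset V) : ℝ :=
  ∑ v ∈ F, I.w v + ∑ p ∈ I.unconnected F, I.pen p

/-- The optimum value. -/
noncomputable def opt : ℝ :=
  (Finset.univ : Finset (Finset V)).inf' Finset.univ_nonempty I.cost

/-! #### The dual with one constraint for every family of vertex sets -/

open scoped Classical in
/-- `Γ(S)`: the vertices outside `S` with a neighbour in `S`. -/
noncomputable def boundary (S : Finset V) : Finset V :=
  Finset.univ.filter fun v => v ∉ S ∧ ∃ u ∈ S, I.G.Adj u v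

open scoped Classical in
/-- The left side of the vertex constraint: the sum of `y_S` over all `S` with `v ∈ Γ(S)`. -/
noncomputable def load (y : Finset V → ℝ) (v : V) : ℝ :=
  ∑ S ∈ Finset.univ.filter (fun S : Finset V => v ∈ I.boundary S), y S

open scoped Classical in
/-- `f(𝕊)`, the right side of the family constraint: the total penalty of the pairs separated by
`𝕊`. -/
noncomputable def familyPenalty (𝕊 : Finset (Finset V)) : ℝ :=
  ∑ p ∈ Finset.univ.filter (fun p : V × V => FamilySeparates 𝕊 p), I.pen p

/-- The vertex constraint of `v` holds with equality. -/
def TightVertex (y : Finset V → ℝ) (v : V) : Prop := I.load y v = I.w v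

/-- The family constraint of `𝕊` holds with equality. -/
def TightFamily (y : Finset V → ℝ) (𝕊 : Finset (Finset V)) : Prop :=
  ∑ S ∈ 𝕊, y S = I.familyPenalty 𝕊

/-- `y` is a feasible solution of the dual linear program. -/
structure DualFeasible (y : Finset V → ℝ) : Prop where
  nonneg : ∀ S, 0 ≤ y S
  vertex : ∀ v, I.load y v ≤ I.w v
  family : ∀ 𝕊 : Finset (Finset V), ∑ S ∈ 𝕊, y S ≤ I.familyPenalty 𝕊

/-! #### The growth phase -/

/-- The algorithm starts with all vertices of weight `0` (listed in any order), no marked pair and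
`y = 0`. -/
def IsInitial (s : PCSFState V) : Prop :=
  s.bought.Nodup ∧ (∀ v, v ∈ s.bought ↔ I.w v = 0) ∧ s.marked = ∅ ∧ s.y = 0

open scoped Classical in
/-- The set `F` of vertices bought so far. -/
noncomputable def boughtSet (s : PCSFState V) : Finset V := s.bought.toFinset

/-- `S` is a moat: the vertex set of a connected component of `G[F]`. -/
def IsMoat (s : PCSFState V) (S : Finset V) : Prop :=
  ∃ c : (I.G.induce (boughtSet s : Set V)).ConnectedComponent,
    (S : Set V) = Subtype.val '' c.supp

/-- `S` is an active moat: it separates an unmarked demand. -/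
def IsActive (s : PCSFState V) (S : Finset V) : Prop :=
  I.IsMoat s S ∧ ∃ p, p ∉ s.marked ∧ I.IsDemand p ∧ Separates S p

open scoped Classical in
/-- The dual variables after those of all active moats have been raised by `ε`. -/
noncomputable def grow (s : PCSFState V) (ε : ℝ) : Finset V → ℝ :=
  fun S => if I.IsActive s S then s.y S + ε else s.y S

/-- Raising the active moats by `ε` yields the new tight vertex `v`. -/
def NewTightVertex (s : PCSFState V) (ε : ℝ) (v : V) : Prop :=
  v ∉ s.bought ∧ I.TightVertex (I.grow s ε) v

/-- Raising the active moats by `ε` yields the new tight family `𝕊`; a tight family is new if it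
separates a demand that is not marked yet. -/
def NewTightFamily (s : PCSFState V) (ε : ℝ) (𝕊 : Finset (Finset V)) : Prop :=
  (∃ p, p ∉ s.marked ∧ I.IsDemand p ∧ FamilySeparates 𝕊 p) ∧ I.TightFamily (I.grow s ε) 𝕊

/-- The values `ε ≥ 0` at which there is a new tight vertex; the minimum is `ε₁`. -/
def vertexTimes (s : PCSFState V) : Set ℝ := {ε | 0 ≤ ε ∧ ∃ v, I.NewTightVertex s ε v}

/-- The values `ε ≥ 0` at which there is a new tight family; the minimum is `ε₂`. -/
def familyTimes (s : PCSFState V) : Set ℝ := {ε | 0 ≤ ε ∧ ∃ 𝕊, I.NewTightFamily s ε 𝕊}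

open scoped Classical in
/-- One iteration of the growth phase. It is performed only while there is an active moat. A minimum
over the empty set counts as infinite, and any new tight vertex or family may be chosen. -/
inductive Step (s : PCSFState V) : PCSFState V → Prop
  /-- `ε₁ ≤ ε₂`: buy a new tight vertex. -/
  | buy (hactive : ∃ S, I.IsActive s S) (ε : ℝ) (v : V)
      (hε₁ : IsLeast (I.vertexTimes s) ε) (hε₂ : ∀ ε' ∈ I.familyTimes s, ε ≤ ε')
      (hv : I.NewTightVertex s ε v) :
      Step s ⟨v :: s.bought, s.marked, I.grow s ε⟩
  /-- `ε₂ < ε₁`: mark all pairs that are separated by a new tight family. -/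
  | mark (hactive : ∃ S, I.IsActive s S) (ε : ℝ) (𝕊 : Finset (Finset V))
      (hε₂ : IsLeast (I.familyTimes s) ε) (hε₁ : ∀ ε' ∈ I.vertexTimes s, ε < ε')
      (h𝕊 : I.NewTightFamily s ε 𝕊) :
      Step s ⟨s.bought, s.marked ∪ Finset.univ.filter (fun p => FamilySeparates 𝕊 p), I.grow s ε⟩

/-- `s` occurs in some run of the algorithm. -/
def Reaches (s : PCSFState V) : Prop :=
  ∃ s₀, I.IsInitial s₀ ∧ Relation.ReflTransGen I.Step s₀ s

/-! #### The pruning phase and the output -/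

open scoped Classical in
/-- Consider `v` for deletion: remove it from `F` if all unmarked demands are still connected. -/
noncomputable def pruneVertex (marked : Finset (V × V)) (F : Finset V) (v : V) : Finset V :=
  if ∀ p, I.IsDemand p → p ∉ marked → I.ConnectedVia (F.erase v) p then F.erase v else F

/-- The pruning phase: all bought vertices are considered in the reverse order of purchase. -/
noncomputable def prune (s : PCSFState V) : Finset V :=
  s.bought.foldl (I.pruneVertex s.marked) (boughtSet s)

/-- Some complete run of the algorithm outputs the vertex set `F'` and the set `Q'` of demands, and
ends with the dual variables `y`. -/
def Outputs (F' : Finset V) (Q' : Finset (V × V)) (y : Finset V → ℝ) : Prop :=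
  ∃ s, I.Reaches s ∧ (∀ S, ¬ I.IsActive s S) ∧
    F' = I.prune s ∧ Q' = I.unconnected F' ∧ y = s.y

end PCSF

/-! Primal-dual accounting. Every kept vertex is tight, so the weight of the output $F'$ is $\sum_S
y_S\,|F'\cap\Gamma(S)|$. It is enough that at every moment of the growth phase $|F'\cap\Gamma(S)|$
averages at most 3 over the active moats $S$ (`sum_card_inter_boundary_le`). For the penalties, the
right side of the family constraint is submodular, so tight families are closed under union and all
marked pairs are the pairs separated by a single tight family; their penalty is a partial sum of
$\sum_S y_S$. Weak duality compares $\sum_S y_S$ with $OPT$.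

For the average degree, let $F$ be the current vertex set and $X$ the later purchases that survive
pruning. Reverse deletion makes each $x\in X$ a cut vertex of the graph on $F\cup X$ that separates
two active moats. Splitting at these cut vertices, with $x$ kept as a terminal on both sides, ends
in pieces without remaining cut vertices. There the bipartite planar bound $|E|\le 2n-4$ applies
after the moats are contracted. It fails only for two vertices joined by an edge, which costs 1 per
moat of degree one; hence $2+1=3$ (`SimpleGraph.sum_adjCount_add_four_le`).

The planar bound is obtained algebraically, in the manner of MacLane. By Euler's formula the facial
walks span the cycle space over $\mathbb F_2$, and each edge lies in at most two of them. Having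
such a generating set survives deletion and contraction of edges (`HasSparseSpan.inf_ker_proj`,
`HasSparseSpan.map_funLeft`), so no minor has to be embedded. In a simple bipartite graph nonzero
cycle vectors have weight at least 4, and double counting gives the bound. -/

/-! ### Facial walks span the cycle space of a planar graph -/

section CycleSpace

open scoped Classical

variable {V : Type*} [Fintype V]

/-- The vertex-edge incidence matrix over `ZMod 2`. -/
noncomputable def SimpleGraph.edgeIncidence (G : SimpleGraph V) : Matrix V G.edgeSet (ZMod 2) :=
  fun v e => if v ∈ e.1 then 1 else 0

/-- The cycle space over `ZMod 2`: the edge sets that have even degree at every vertex. -/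
noncomputable def SimpleGraph.cycleSpace (G : SimpleGraph V) :
    Submodule (ZMod 2) (G.edgeSet → ZMod 2) :=
  LinearMap.ker G.edgeIncidence.mulVecLin

/-- A code with a generating set in which every coordinate is nonzero at most twice. -/
def HasSparseSpan {E : Type*} (Z : Submodule (ZMod 2) (E → ZMod 2)) : Prop :=
  ∃ s : Finset (E → ZMod 2), Submodule.span (ZMod 2) (s : Set (E → ZMod 2)) = Z ∧
    ∀ e, (s.filter fun b => b e ≠ 0).card ≤ 2

theorem SimpleGraph.edgeIncidence_mulVec (G : SimpleGraph V) (z : G.edgeSet → ZMod 2) (v : V) :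
    G.edgeIncidence.mulVecLin z v = ∑ e : G.edgeSet, if v ∈ e.1 then z e else 0 := by
  simp [Matrix.mulVec, dotProduct, edgeIncidence]

theorem SimpleGraph.edgeIncidence_transpose_mulVec (G : SimpleGraph V) (g : V → ZMod 2)
    {a b : V} (h : G.Adj a b) :
    G.edgeIncidence.transpose.mulVecLin g ⟨s(a, b), h⟩ = g a + g b := by
  have hab := h.ne
  simp only [Matrix.mulVecLin_apply, Matrix.mulVec, dotProduct, edgeIncidence,
    Matrix.transpose_apply, Sym2.mem_iff, ite_mul, one_mul, zero_mul]
  rw [← Finset.sum_filter]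
  have : (Finset.univ.filter fun x => x = a ∨ x = b) = {a, b} := by ext; simp
  rw [this, Finset.sum_pair hab]

theorem ZMod.two_eq_of_add_eq_zero {a b : ZMod 2} (h : a + b = 0) : a = b := by
  revert a b; decide

theorem ZMod.two_eq_one_of_ne_zero {a : ZMod 2} (h : a ≠ 0) : a = 1 := by
  revert a; decide

theorem ZMod.two_add_self (a : ZMod 2) : a + a = 0 := by
  revert a; decide

/-- Rank-nullity for the incidence matrix and for its transpose. A vector in the kernel of the
transpose is constant along edges, hence is pulled back from the components, so the rank is at least
the number of vertices minus the number of components. -/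
theorem SimpleGraph.finrank_cycleSpace_add_card_le (G : SimpleGraph V) :
    Module.finrank (ZMod 2) G.cycleSpace + Nat.card V ≤
      Nat.card G.edgeSet + Nat.card G.ConnectedComponent := by
  have h1 := LinearMap.finrank_range_add_finrank_ker G.edgeIncidence.mulVecLin
  have h2 := LinearMap.finrank_range_add_finrank_ker G.edgeIncidence.transpose.mulVecLin
  have h3 := G.edgeIncidence.rank_transpose
  unfold Matrix.rank at h3
  rw [Module.finrank_pi] at h1 h2
  have h4 : Module.finrank (ZMod 2) (LinearMap.ker G.edgeIncidence.transpose.mulVecLin) ≤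
      Nat.card G.ConnectedComponent := by
    have hc : Module.finrank (ZMod 2) (G.ConnectedComponent → ZMod 2) =
        Nat.card G.ConnectedComponent := by
      rw [Module.finrank_pi, Nat.card_eq_fintype_card]
    rw [← hc]
    let ψ : (G.ConnectedComponent → ZMod 2) →ₗ[ZMod 2] (V → ZMod 2) :=
      LinearMap.funLeft (ZMod 2) (ZMod 2) G.connectedComponentMk
    refine le_trans (Submodule.finrank_mono (t := LinearMap.range ψ) ?_) (LinearMap.finrank_range_le ψ)
    intro g hg
    have hadj : ∀ a b, G.Adj a b → g a = g b := by
      intro a b h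
      have := congrFun (LinearMap.mem_ker.1 hg) ⟨s(a, b), h⟩
      rw [G.edgeIncidence_transpose_mulVec g h] at this
      exact ZMod.two_eq_of_add_eq_zero this
    refine ⟨fun c => c.lift g ?_, ?_⟩
    · intro v w p _
      clear hg
      induction p with
      | nil => rfl
      | cons h p ih => exact (hadj _ _ h).trans (ih (by simp_all [SimpleGraph.Walk.cons_isPath_iff]))
    · ext v; simp [ψ, LinearMap.funLeft]
  rw [Nat.card_eq_fintype_card, Nat.card_eq_fintype_card (α := G.edgeSet)]
  unfold cycleSpace
  omega

/-- The facial walk that contains a dart. -/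
def dartFace {V : Type*} (G : SimpleGraph V) (σ : Equiv.Perm G.Dart) (d : G.Dart) :
    RotationFaces G σ := Quotient.mk _ d

/-- The combination of the facial walks with the given coefficients. -/
noncomputable def faceMap (G : SimpleGraph V) (σ : Equiv.Perm G.Dart) :
    (RotationFaces G σ → ZMod 2) →ₗ[ZMod 2] (G.edgeSet → ZMod 2) where
  toFun l e := ∑ d : G.Dart, if d.edge = e.1 then l (dartFace G σ d) else 0
  map_add' l m := by
    ext e; simp only [Pi.add_apply, ← Finset.sum_add_distrib]
    exact Finset.sum_congr rfl fun d _ => by split_ifs <;> simp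
  map_smul' c l := by
    ext e; simp only [Pi.smul_apply, Finset.smul_sum, RingHom.id_apply]
    exact Finset.sum_congr rfl fun d _ => by split_ifs <;> simp

theorem faceMap_apply (G : SimpleGraph V) (σ : Equiv.Perm G.Dart) (l : RotationFaces G σ → ZMod 2)
    (d : G.Dart) :
    faceMap G σ l ⟨d.edge, d.edge_mem⟩ = l (dartFace G σ d) + l (dartFace G σ d.symm) := by
  change (∑ d' : G.Dart, if d'.edge = d.edge then _ else 0) = _
  rw [← Finset.sum_filter, SimpleGraph.Dart.edge_fiber, Finset.sum_pair d.symm_ne.symm]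

theorem dartFace_apply_symm {V : Type*} (G : SimpleGraph V) (σ : Equiv.Perm G.Dart) (d : G.Dart) :
    dartFace G σ (σ d.symm) = dartFace G σ d := by
  refine Quotient.sound (s := Equiv.Perm.SameCycle.setoid (σ * dartReversal G)) ?_
  change (σ * dartReversal G).SameCycle (σ d.symm) d
  have : σ d.symm = (σ * dartReversal G) d := rfl
  rw [this]
  exact Equiv.Perm.sameCycle_apply_left.2 (Equiv.Perm.SameCycle.refl _ _)

/-- A facial walk leaves a vertex as often as it enters it: the bijection from a dart to its
successor on the face matches the darts into `v` with those out of `v` and preserves the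
coefficient, so the degree at `v` is twice a sum. -/
theorem range_faceMap_le (G : SimpleGraph V) (σ : Equiv.Perm G.Dart) (hσ : IsRotationSystem G σ) :
    LinearMap.range (faceMap G σ) ≤ G.cycleSpace := by
  rintro _ ⟨l, rfl⟩
  refine LinearMap.mem_ker.2 (funext fun v => ?_)
  rw [G.edgeIncidence_mulVec]
  have h1 : ∀ e : G.edgeSet, (if v ∈ e.1 then faceMap G σ l e else 0) =
      ∑ d : G.Dart, if d.edge = e.1 then (if v ∈ d.edge then l (dartFace G σ d) else 0) else 0 := by
    intro e
    change (if v ∈ e.1 then (∑ d : G.Dart, if d.edge = e.1 then l (dartFace G σ d) else 0) else 0) = _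
    split_ifs with h
    · refine Finset.sum_congr rfl fun d _ => ?_
      by_cases hd : d.edge = e.1
      · simp [hd, h]
      · simp [hd]
    · symm
      refine Finset.sum_eq_zero fun d _ => ?_
      by_cases hd : d.edge = e.1
      · simp [hd, h]
      · simp [hd]
  simp_rw [h1]
  rw [Finset.sum_comm]
  have h2 : ∀ d : G.Dart, (∑ e : G.edgeSet,
      if d.edge = e.1 then (if v ∈ d.edge then l (dartFace G σ d) else 0) else 0) =
      (if v = d.fst then l (dartFace G σ d) else 0) +
        (if v = d.snd then l (dartFace G σ d) else 0) := by
    intro d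
    rw [Finset.sum_eq_single ⟨d.edge, d.edge_mem⟩]
    · have hne : d.fst ≠ d.snd := d.adj.ne
      have hm : v ∈ d.edge ↔ v = d.fst ∨ v = d.snd := by
        rw [SimpleGraph.Dart.edge]; exact Sym2.mem_iff
      by_cases h3 : v = d.fst
      · have h4 : v ≠ d.snd := h3 ▸ hne
        rw [if_pos (hm.2 (Or.inl h3)), if_pos h3, if_neg h4, add_zero, if_pos rfl]
      · simp [hm, h3]
    · intro e _ he
      rw [if_neg]
      intro h; exact he (Subtype.ext h.symm)
    · simp
  simp_rw [h2]
  rw [Finset.sum_add_distrib]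
  let φ : G.Dart ≃ G.Dart := (dartReversal G).trans σ
  have h3 : (∑ d : G.Dart, if v = d.snd then l (dartFace G σ d) else 0) =
      ∑ d : G.Dart, if v = d.fst then l (dartFace G σ d) else 0 := by
    rw [← Equiv.sum_comp φ (fun d : G.Dart => if v = d.fst then l (dartFace G σ d) else 0)]
    refine Finset.sum_congr rfl fun d _ => ?_
    have hφ : φ d = σ d.symm := rfl
    have hf : (σ d.symm).fst = d.snd :=
      ((hσ (σ d.symm) d.symm).1 (Equiv.Perm.sameCycle_apply_left.2 (.refl _ _)))
    rw [hφ, hf, dartFace_apply_symm]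
  rw [h3]
  exact ZMod.two_add_self _

instance (G : SimpleGraph V) (σ : Equiv.Perm G.Dart) : Finite (RotationFaces G σ) :=
  Quotient.finite _

/-- Coefficients in the kernel agree on the two sides of each edge. They are then also invariant
under rotation around a vertex, hence constant along walks, and one value per component with an edge
determines them. The components of isolated vertices are not among these. -/
theorem finrank_ker_faceMap_add_card_le (G : SimpleGraph V) (σ : Equiv.Perm G.Dart)
    (hσ : IsRotationSystem G σ) :
    Module.finrank (ZMod 2) (LinearMap.ker (faceMap G σ)) + Nat.card {v : V // ∀ u, ¬ G.Adj v u} ≤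
      Nat.card G.ConnectedComponent := by
  let D := {c : G.ConnectedComponent // ∃ d : G.Dart, G.connectedComponentMk d.fst = c}
  have hD : Nat.card D + Nat.card {v : V // ∀ u, ¬ G.Adj v u} ≤ Nat.card G.ConnectedComponent := by
    rw [← Nat.card_sum]
    refine Nat.card_le_card_of_injective
      (Sum.elim Subtype.val fun v => G.connectedComponentMk v.1) ?_
    have key : ∀ (v : {v : V // ∀ u, ¬ G.Adj v u}) (w : V),
        G.Reachable v.1 w → v.1 = w := by
      rintro ⟨v, hv⟩ w ⟨p⟩
      cases p with
      | nil => rfl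
      | cons h p => exact absurd h (hv _)
    refine Function.Injective.sumElim Subtype.val_injective ?_ ?_
    · intro v w h
      exact Subtype.ext (key v w (SimpleGraph.ConnectedComponent.eq.1 h))
    · rintro ⟨_, d, rfl⟩ v h
      have := key v d.fst (SimpleGraph.ConnectedComponent.eq.1 h.symm)
      exact v.2 d.snd (this ▸ d.adj)
  refine le_trans (Nat.add_le_add_right ?_ _) hD
  have hc : Module.finrank (ZMod 2) (D → ZMod 2) = Nat.card D := by
    rw [Module.finrank_pi, Nat.card_eq_fintype_card]
  rw [← hc]
  let S : Submodule (ZMod 2) (RotationFaces G σ → ZMod 2) := LinearMap.ker (faceMap G σ)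
  let dart : D → G.Dart := fun c => c.2.choose
  let ψ : S →ₗ[ZMod 2] (D → ZMod 2) :=
    (LinearMap.funLeft (ZMod 2) (ZMod 2) fun c : D => dartFace G σ (dart c)).comp
      S.subtype
  refine LinearMap.finrank_le_finrank_of_injective (f := ψ) ?_
  rw [← LinearMap.ker_eq_bot, LinearMap.ker_eq_bot']
  rintro ⟨l, hl⟩ h0
  let g : G.Dart → ZMod 2 := fun d => l (dartFace G σ d)
  have hτ : ∀ d, g d = g d.symm := fun d => by
    have := congrFun (LinearMap.mem_ker.1 hl) ⟨d.edge, d.edge_mem⟩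
    rw [faceMap_apply] at this
    exact ZMod.two_eq_of_add_eq_zero this
  have hσ1 : ∀ d, g (σ d) = g d := fun d => by
    have h := dartFace_apply_symm G σ d.symm
    rw [SimpleGraph.Dart.symm_symm] at h
    change l _ = l _
    rw [h]; exact (hτ d).symm
  have hcyc : ∀ d e, σ.SameCycle d e → g d = g e := by
    rintro d e ⟨n, rfl⟩
    induction n using Int.induction_on with
    | zero => rfl
    | succ n ih => rw [add_comm, zpow_add, zpow_one, Equiv.Perm.mul_apply, hσ1, ih]
    | pred n ih =>
      rw [ih, ← hσ1 ((σ ^ (-(n : ℤ) - 1)) d), ← Equiv.Perm.mul_apply, ← zpow_one_add]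
      congr 2; ring_nf
  have hfst : ∀ d e : G.Dart, d.fst = e.fst → g d = g e := fun d e h => hcyc d e ((hσ d e).2 h)
  have hwalk : ∀ u v, G.Walk u v → ∀ d e : G.Dart, d.fst = u → e.fst = v → g d = g e := by
    intro u v p
    induction p with
    | nil => intro d e hd he; exact hfst d e (hd.trans he.symm)
    | @cons u w v h p ih =>
      intro d e hd he
      let d' : G.Dart := ⟨(u, w), h⟩
      rw [hfst d d' hd, hτ d']
      exact ih d'.symm e rfl he
  refine Subtype.ext (funext fun f => ?_)
  obtain ⟨d, rfl⟩ : ∃ d, dartFace G σ d = f := Quotient.exists_rep f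
  let c : D := ⟨G.connectedComponentMk d.fst, d, rfl⟩
  have h1 : g (dart c) = 0 := congrFun h0 c
  obtain ⟨p⟩ := SimpleGraph.ConnectedComponent.eq.1 (c.2.choose_spec)
  exact (hwalk _ _ p (dart c) d rfl rfl).symm.trans h1

/-- With Euler's formula, the upper bounds on the dimension of the kernel of `faceMap` and on that
of the cycle space leave no room between the range of `faceMap` and the cycle space. An edge is
covered only by the faces of its two darts. -/
theorem hasSparseSpan_cycleSpace_of_isPlanarGraph (G : SimpleGraph V) (h : IsPlanarGraph G) :
    HasSparseSpan G.cycleSpace := by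
  obtain ⟨σ, hσ, hE⟩ := h
  have := Fintype.ofFinite (RotationFaces G σ)
  have hr : LinearMap.range (faceMap G σ) = G.cycleSpace := by
    refine Submodule.eq_of_le_of_finrank_le (range_faceMap_le G σ hσ) ?_
    have h1 := LinearMap.finrank_range_add_finrank_ker (faceMap G σ)
    have h2 := G.finrank_cycleSpace_add_card_le
    have h3 := finrank_ker_faceMap_add_card_le G σ hσ
    rw [Module.finrank_pi, ← Nat.card_eq_fintype_card] at h1
    omega
  refine ⟨Finset.univ.image fun f => faceMap G σ (Pi.single f 1), ?_, ?_⟩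
  · rw [← hr, LinearMap.range_eq_map, ← (Pi.basisFun (ZMod 2) (RotationFaces G σ)).span_eq,
      Submodule.map_span, Finset.coe_image, Finset.coe_univ, Set.image_univ, ← Set.range_comp]
    congr 2
  · rintro ⟨e, he⟩
    induction e with
    | h a b =>
    let d : G.Dart := ⟨(a, b), he⟩
    refine le_trans (Finset.card_le_card (t := ({dartFace G σ d, dartFace G σ d.symm} :
      Finset (RotationFaces G σ)).image fun f => faceMap G σ (Pi.single f 1)) ?_)
      (Finset.card_image_le.trans Finset.card_le_two)
    intro v hv
    obtain ⟨hv, hne⟩ := Finset.mem_filter.1 hv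
    obtain ⟨f, -, rfl⟩ := Finset.mem_image.1 hv
    refine Finset.mem_image_of_mem _ ?_
    by_contra hf
    simp only [Finset.mem_insert, Finset.mem_singleton, not_or] at hf
    apply hne
    change faceMap G σ (Pi.single f 1) ⟨d.edge, d.edge_mem⟩ = 0
    rw [faceMap_apply, Pi.single_eq_of_ne (Ne.symm hf.1), Pi.single_eq_of_ne (Ne.symm hf.2), add_zero]

end CycleSpace

/-! ### Sparse generating sets: deletion, contraction and double counting -/

section SparseSpan

open scoped Classical

variable {E : Type*}

/-- Deleting an edge merges the two faces beside it: if the generator `b₁` passes through `e`, it is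
added to the other generator through `e`, if there is one, and then dropped. The map `T` does this
and projects `Z` onto its vectors vanishing at `e`. -/
theorem HasSparseSpan.inf_ker_proj {Z : Submodule (ZMod 2) (E → ZMod 2)} (h : HasSparseSpan Z)
    (e : E) : HasSparseSpan (Z ⊓ LinearMap.ker (LinearMap.proj (R := ZMod 2) (φ := fun _ : E => ZMod 2) e)) := by
  obtain ⟨s, hs, h2⟩ := h
  by_cases hb : ∃ b ∈ s, b e ≠ 0
  swap
  · push Not at hb
    refine ⟨s, ?_, h2⟩
    rw [hs, eq_comm, inf_eq_left, ← hs, Submodule.span_le]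
    exact fun b hbs => hb b hbs
  obtain ⟨b₁, hb₁, hne⟩ := hb
  have h1 : b₁ e = 1 := ZMod.two_eq_one_of_ne_zero hne
  let T : (E → ZMod 2) →ₗ[ZMod 2] (E → ZMod 2) :=
    LinearMap.id - (LinearMap.proj (R := ZMod 2) (φ := fun _ : E => ZMod 2) e).smulRight b₁
  have hT : ∀ z, T z = z - z e • b₁ := fun z => rfl
  refine ⟨s.image T, ?_, ?_⟩
  · rw [Finset.coe_image, ← Submodule.map_span, hs]
    apply le_antisymm
    · rintro _ ⟨z, hz, rfl⟩
      refine ⟨?_, ?_⟩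
      · rw [hT]
        exact Z.sub_mem hz (Z.smul_mem _ (hs ▸ Submodule.subset_span hb₁))
      · simp [hT, h1]
    · rintro z ⟨hz, h0⟩
      refine ⟨z, hz, ?_⟩
      have h0 : z e = 0 := h0
      rw [hT, h0, zero_smul, sub_zero]
  · intro e'
    have hT1 : T b₁ = 0 := by rw [hT, h1, one_smul, sub_self]
    have huniq : ∀ b ∈ s, b e ≠ 0 → b ≠ b₁ → ∀ c ∈ s, c e ≠ 0 → c ≠ b₁ → b = c := by
      intro b hbs hbe hb1 c hcs hce hc1
      by_contra hbc
      have : ({b₁, b, c} : Finset (E → ZMod 2)) ⊆ s.filter fun b => b e ≠ 0 := by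
        intro x hx
        simp only [Finset.mem_insert, Finset.mem_singleton] at hx
        rcases hx with rfl | rfl | rfl <;> simp [*]
      have h3 := (Finset.card_le_card this).trans (h2 e)
      rw [Finset.card_eq_three.2 ⟨b₁, b, c, hb1.symm, hc1.symm, hbc, rfl⟩] at h3
      omega
    have hsub : (s.image T).filter (fun b => b e' ≠ 0) ⊆
        (s.filter fun b => T b e' ≠ 0).image T := by
      intro x hx
      obtain ⟨hx, hxe⟩ := Finset.mem_filter.1 hx
      obtain ⟨b, hbs, rfl⟩ := Finset.mem_image.1 hx
      exact Finset.mem_image_of_mem _ (Finset.mem_filter.2 ⟨hbs, hxe⟩)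
    refine (Finset.card_le_card hsub).trans (Finset.card_image_le.trans (le_trans ?_ (h2 e')))
    -- A generator that becomes nonzero at `e'` only through the addition of `b₁` is charged to
    -- `b₁`, which is itself nonzero there; all others are charged to themselves. By `huniq` at most
    -- one generator is charged to `b₁`, and `b₁` is not charged to itself because `T b₁ = 0`.
    refine Finset.card_le_card_of_injOn
      (fun b => if b e ≠ 0 ∧ b e' = 0 then b₁ else b) ?_ ?_
    · intro b hb
      obtain ⟨hbs, hbe⟩ := Finset.mem_filter.1 hb
      rw [hT] at hbe
      refine Finset.mem_filter.2 ?_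
      by_cases hc : b e ≠ 0 ∧ b e' = 0
      · simp only [hc, ne_eq, not_false_eq_true, and_self, if_true]
        refine ⟨hb₁, fun h => hbe ?_⟩
        simp [hc.2, h]
      · simp only [if_neg hc]
        refine ⟨hbs, fun h => ?_⟩
        have : b e = 0 := by by_contra h'; exact hc ⟨h', h⟩
        simp [this, h] at hbe
    · intro b hb c hc hbc
      obtain ⟨hbs, hbe⟩ := Finset.mem_filter.1 hb
      obtain ⟨hcs, hce⟩ := Finset.mem_filter.1 hc
      have hb1 : b ≠ b₁ := by rintro rfl; simp [hT1] at hbe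
      have hc1 : c ≠ b₁ := by rintro rfl; simp [hT1] at hce
      dsimp only at hbc
      split_ifs at hbc with h3 h4 h4
      · exact huniq b hbs h3.1 hb1 c hcs h4.1 hc1
      · exact absurd hbc.symm hc1
      · exact absurd hbc hb1
      · exact hbc

theorem HasSparseSpan.inf_vanishing {Z : Submodule (ZMod 2) (E → ZMod 2)} (h : HasSparseSpan Z)
    (D : Finset E) :
    HasSparseSpan (Z ⊓ ⨅ e ∈ D,
      LinearMap.ker (LinearMap.proj (R := ZMod 2) (φ := fun _ : E => ZMod 2) e)) := by
  induction D using Finset.induction_on with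
  | empty => simpa using h
  | insert a s ha ih =>
    rw [Finset.iInf_insert, inf_comm (LinearMap.ker _), ← inf_assoc]
    exact ih.inf_ker_proj a

/-- For injective `f`, restricting cycle vectors to the edges in its range corresponds to
contracting the other edges. -/
theorem HasSparseSpan.map_funLeft {P : Type*} {Z : Submodule (ZMod 2) (E → ZMod 2)}
    (h : HasSparseSpan Z) (f : P → E) :
    HasSparseSpan (Z.map (LinearMap.funLeft (ZMod 2) (ZMod 2) f)) := by
  obtain ⟨s, hs, h2⟩ := h
  refine ⟨s.image (LinearMap.funLeft (ZMod 2) (ZMod 2) f), ?_, fun p => ?_⟩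
  · rw [Finset.coe_image, ← Submodule.map_span, hs]
  · refine le_trans (Finset.card_le_card (t := (s.filter fun b => b (f p) ≠ 0).image
      (LinearMap.funLeft (ZMod 2) (ZMod 2) f)) ?_) (Finset.card_image_le.trans (h2 (f p)))
    intro x hx
    obtain ⟨hx, hxe⟩ := Finset.mem_filter.1 hx
    obtain ⟨b, hbs, rfl⟩ := Finset.mem_image.1 hx
    exact Finset.mem_image_of_mem _ (Finset.mem_filter.2 ⟨hbs, hxe⟩)

/-- A basis is chosen among the generators. Its sum, which plays the part of the outer face, is one
more nonzero vector of weight at least 4. A coordinate covered twice by the basis is not covered by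
the sum, so all these vectors together still cover each coordinate at most twice. -/
theorem HasSparseSpan.four_mul_finrank_add_one_le [Fintype E]
    {Z : Submodule (ZMod 2) (E → ZMod 2)} (h : HasSparseSpan Z)
    (hw : ∀ z ∈ Z, z ≠ 0 → 4 ≤ (Finset.univ.filter fun e => z e ≠ 0).card)
    (hk : 1 ≤ Module.finrank (ZMod 2) Z) :
    4 * (Module.finrank (ZMod 2) Z + 1) ≤ 2 * Fintype.card E := by
  obtain ⟨s, hs, h2⟩ := h
  obtain ⟨t', ht's, htspan, hli⟩ :=
    exists_linearIndependent (ZMod 2) (s : Set (E → ZMod 2))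
  obtain ⟨t, rfl⟩ : ∃ t : Finset (E → ZMod 2), (t : Set (E → ZMod 2)) = t' :=
    (s.finite_toSet.subset ht's).exists_finset_coe
  have hts : t ⊆ s := ht's
  have hcard : t.card = Module.finrank (ZMod 2) Z := by
    rw [← hs, ← htspan, finrank_span_finset_eq_card hli]
  have hmem : ∀ b ∈ t, b ∈ Z := fun b hb => hs ▸ Submodule.subset_span (hts hb)
  have hne0 : ∀ b ∈ t, b ≠ 0 := fun b hb => hli.ne_zero (⟨b, hb⟩ : (t : Set (E → ZMod 2)))
  have hsum0 : ∑ b ∈ t, b ≠ 0 := by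
    intro h0
    obtain ⟨b, hb⟩ := Finset.card_pos.1 (show 0 < t.card by omega)
    have := (linearIndepOn_finset_iff (v := id) (s := t)).1 hli (fun _ => (1 : ZMod 2)) (by simpa using h0) b hb
    exact one_ne_zero this
  have hW : ∑ b ∈ t, (Finset.univ.filter fun e => b e ≠ 0).card +
      (Finset.univ.filter fun e => (∑ b ∈ t, b) e ≠ 0).card ≤ 2 * Fintype.card E := by
    simp_rw [Finset.card_filter]
    rw [Finset.sum_comm, ← Finset.sum_add_distrib, mul_comm, ← smul_eq_mul]
    refine Finset.sum_le_card_nsmul _ _ _ fun e _ => ?_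
    rw [← Finset.card_filter]
    have hle : (t.filter fun b => b e ≠ 0).card ≤ 2 :=
      (Finset.card_le_card (Finset.filter_subset_filter _ hts)).trans (h2 e)
    have hval : (∑ b ∈ t, b) e = ((t.filter fun b => b e ≠ 0).card : ZMod 2) := by
      rw [Finset.sum_apply, Finset.card_filter, Nat.cast_sum]
      refine Finset.sum_congr rfl fun b _ => ?_
      split_ifs with hb
      · rw [ZMod.two_eq_one_of_ne_zero hb, Nat.cast_one]
      · rw [not_not.1 hb, Nat.cast_zero]
    rcases Nat.lt_or_ge (t.filter fun b => b e ≠ 0).card 2 with h' | h'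
    · split_ifs <;> omega
    · have : (t.filter fun b => b e ≠ 0).card = 2 := le_antisymm hle h'
      rw [hval, this]
      simp [show (2 : ZMod 2) = 0 from rfl]
  have hlow : 4 * t.card ≤ ∑ b ∈ t, (Finset.univ.filter fun e => b e ≠ 0).card := by
    rw [mul_comm, ← smul_eq_mul]
    exact Finset.card_nsmul_le_sum _ _ _ fun b hb => hw b (hmem b hb) (hne0 b hb)
  have hlast := hw _ (Z.sum_mem hmem) hsum0
  omega

end SparseSpan

/-! ### Simple bipartite graphs with a sparse cycle space have at most $2n-4$ edges -/

section EvenCode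

open scoped Classical

variable {P α β : Type*} [Fintype P]

/-- The degrees modulo two of an edge set of the bipartite graph with edge set `P`, where `p` joins
`f p` and `g p`. -/
noncomputable def bipartiteBoundary (f : P → α) (g : P → β) :
    (P → ZMod 2) →ₗ[ZMod 2] (α ⊕ β → ZMod 2) where
  toFun y := Sum.elim (fun a => ∑ p, if f p = a then y p else 0)
    (fun b => ∑ p, if g p = b then y p else 0)
  map_add' y z := by
    ext (a | b) <;> simp only [Pi.add_apply, Sum.elim_inl, Sum.elim_inr, ← Finset.sum_add_distrib] <;>
    exact Finset.sum_congr rfl fun d _ => by split_ifs <;> simp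
  map_smul' c y := by
    ext (a | b) <;>
    simp only [Pi.smul_apply, Sum.elim_inl, Sum.elim_inr, Finset.smul_sum, RingHom.id_apply] <;>
    exact Finset.sum_congr rfl fun d _ => by split_ifs <;> simp

theorem mem_ker_bipartiteBoundary {f : P → α} {g : P → β} {y : P → ZMod 2} :
    y ∈ LinearMap.ker (bipartiteBoundary f g) ↔
      (∀ a, (∑ p, if f p = a then y p else 0) = 0) ∧
      ∀ b, (∑ p, if g p = b then y p else 0) = 0 := by
  rw [LinearMap.mem_ker]
  constructor
  · intro h
    exact ⟨fun a => congrFun h (Sum.inl a), fun b => congrFun h (Sum.inr b)⟩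
  · rintro ⟨h1, h2⟩
    ext (a | b)
    exacts [h1 a, h2 b]

/-- Every edge has two ends, so the degree vectors lie in the hyperplane of coordinate sum zero and
the rank is at most the number of vertices minus one. -/
theorem card_add_one_le_finrank_ker_bipartiteBoundary [Fintype α] [Fintype β] (f : P → α) (g : P → β)
    (hn : 1 ≤ Fintype.card α + Fintype.card β) :
    Fintype.card P + 1 ≤ Module.finrank (ZMod 2) (LinearMap.ker (bipartiteBoundary f g)) +
      (Fintype.card α + Fintype.card β) := by
  have h1 := LinearMap.finrank_range_add_finrank_ker (bipartiteBoundary f g)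
  let s : (α ⊕ β → ZMod 2) →ₗ[ZMod 2] ZMod 2 :=
    ∑ i, LinearMap.proj (R := ZMod 2) (φ := fun _ : α ⊕ β => ZMod 2) i
  have hs : ∀ x, s x = ∑ i, x i := fun x => by simp [s]
  have hle : LinearMap.range (bipartiteBoundary f g) ≤ LinearMap.ker s := by
    rintro _ ⟨y, rfl⟩
    rw [LinearMap.mem_ker, hs, Fintype.sum_sum_type]
    change (∑ a, ∑ p, if f p = a then y p else 0) + (∑ b, ∑ p, if g p = b then y p else 0) = 0
    rw [Finset.sum_comm, Finset.sum_comm (s := (Finset.univ : Finset β))]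
    simp only [Finset.sum_ite_eq, Finset.mem_univ, if_true]
    exact ZMod.two_add_self _
  have h2 := Submodule.finrank_mono hle
  have h3 := LinearMap.finrank_range_add_finrank_ker s
  have hsurj : LinearMap.range s = ⊤ := by
    rw [LinearMap.range_eq_top]
    intro c
    obtain ⟨i⟩ : Nonempty (α ⊕ β) := by
      rw [← Fintype.card_pos_iff, Fintype.card_sum]; omega
    exact ⟨Pi.single i c, by rw [hs, Finset.sum_pi_single']; simp⟩
  rw [hsurj, finrank_top, Module.finrank_self, Module.finrank_pi, Fintype.card_sum] at h3
  rw [Module.finrank_pi] at h1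
  omega

theorem exists_ne_of_sum_fiber_eq_zero {γ : Type*} {f : P → γ} {y : P → ZMod 2} {a : γ}
    (h : (∑ p, if f p = a then y p else 0) = 0) {p : P} (hp : f p = a) (hy : y p ≠ 0) :
    ∃ q, q ≠ p ∧ f q = a ∧ y q ≠ 0 := by
  by_contra! hq
  rw [Finset.sum_eq_single p] at h
  · rw [if_pos hp] at h; exact hy h
  · intro q _ hqp
    split_ifs with hqa
    · exact hq q hqp hqa
    · rfl
  · simp

/-- From an edge `p` of the support, even degrees give a second edge `q` at its left end, a second
edge `r` at its right end, and a second edge `t` at the right end of `q`. Without parallel edges the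
four are distinct. -/
theorem four_le_card_of_mem_ker_bipartiteBoundary {f : P → α} {g : P → β}
    (hinj : Function.Injective fun p => (f p, g p)) {y : P → ZMod 2}
    (hy : y ∈ LinearMap.ker (bipartiteBoundary f g)) (h0 : y ≠ 0) :
    4 ≤ (Finset.univ.filter fun p => y p ≠ 0).card := by
  obtain ⟨h1, h2⟩ := mem_ker_bipartiteBoundary.1 hy
  obtain ⟨p, hp⟩ := Function.ne_iff.1 h0
  obtain ⟨q, hqp, hq, hyq⟩ := exists_ne_of_sum_fiber_eq_zero (h1 (f p)) rfl hp
  obtain ⟨r, hrp, hr, hyr⟩ := exists_ne_of_sum_fiber_eq_zero (h2 (g p)) rfl hp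
  obtain ⟨t, htq, ht, hyt⟩ := exists_ne_of_sum_fiber_eq_zero (h2 (g q)) rfl hyq
  have hf : ∀ {a b : P}, f a = f b → g a = g b → a = b := fun h h' => hinj (Prod.ext h h')
  have hgqp : g q ≠ g p := fun h => hqp (hf hq h)
  have hfrp : f r ≠ f p := fun h => hrp (hf h hr)
  have : ({p, q, r, t} : Finset P) ⊆ Finset.univ.filter fun p => y p ≠ 0 := by
    intro x hx
    simp only [Finset.mem_insert, Finset.mem_singleton] at hx
    rcases hx with rfl | rfl | rfl | rfl <;> simp_all
  refine le_trans (le_of_eq ?_) (Finset.card_le_card this)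
  have hqr : q ≠ r := by rintro rfl; exact hfrp hq
  have hpt : p ≠ t := by rintro rfl; exact hgqp ht.symm
  have hrt : r ≠ t := by rintro rfl; exact hgqp (ht.symm.trans hr)
  rw [Finset.card_insert_of_notMem (by simp [hqp.symm, hrp.symm, hpt]),
    Finset.card_insert_of_notMem (by simp [hqr, htq.symm]),
    Finset.card_insert_of_notMem (by simp [hrt]), Finset.card_singleton]

/-- With $k$ the dimension and $n$ the number of vertices, $|P|+1-n\le k$ and $4(k+1)\le 2|P|$ give
the bound. If $k=0$ the first inequality is enough because $n\ge 3$. -/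
theorem card_add_four_le_of_hasSparseSpan [Fintype α] [Fintype β] {f : P → α} {g : P → β}
    (hinj : Function.Injective fun p => (f p, g p))
    (h : HasSparseSpan (LinearMap.ker (bipartiteBoundary f g)))
    (hn : 3 ≤ Fintype.card α + Fintype.card β) :
    Fintype.card P + 4 ≤ 2 * (Fintype.card α + Fintype.card β) := by
  have h1 := card_add_one_le_finrank_ker_bipartiteBoundary f g (by omega)
  have h2 := h.four_mul_finrank_add_one_le
    fun z hz h0 => four_le_card_of_mem_ker_bipartiteBoundary hinj hz h0
  omega

end EvenCode

/-! ### Contracting disjoint connected sets -/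

section Minor

open scoped Classical

variable {V : Type*} [Fintype V]

theorem SimpleGraph.edgeIncidence_mulVec_single (G : SimpleGraph V) {a b : V} (h : G.Adj a b) :
    G.edgeIncidence.mulVecLin (Pi.single ⟨s(a, b), h⟩ 1) = Pi.single a 1 + Pi.single b 1 := by
  have hab := h.ne
  ext v
  rw [G.edgeIncidence_mulVec, Finset.sum_eq_single ⟨s(a, b), h⟩]
  · simp only [Sym2.mem_iff, Pi.single_eq_same, Pi.add_apply, Pi.single_apply]
    by_cases h1 : v = a
    · simp [h1, hab]
    · simp [h1]
  · intro e _ he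
    rw [Pi.single_eq_of_ne he, ite_self]
  · simp

/-- In a connected vertex set `S`, every even set of vertices of `S` is the set of odd-degree
vertices of a set of edges inside `S`. -/
theorem SimpleGraph.exists_edgeIncidence_mulVec_eq (G : SimpleGraph V) (S : Finset V)
    (hS : (G.induce (S : Set V)).Preconnected) (d : V → ZMod 2) (hd : ∀ v ∉ S, d v = 0)
    (hsum : ∑ v ∈ S, d v = 0) :
    ∃ c : G.edgeSet → ZMod 2, (∀ e, c e ≠ 0 → ∀ v ∈ e.1, v ∈ S) ∧
      G.edgeIncidence.mulVecLin c = d := by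
  let C : Submodule (ZMod 2) (G.edgeSet → ZMod 2) :=
    { carrier := {c | ∀ e, c e ≠ 0 → ∀ v ∈ e.1, v ∈ S}
      add_mem' := by
        intro a b ha hb e he
        by_cases h : a e = 0
        · exact hb e (by intro h'; exact he (by simp [h, h']))
        · exact ha e h
      zero_mem' := by intro e he; exact absurd rfl he
      smul_mem' := by
        intro r a ha e he
        exact ha e (by intro h; exact he (by simp [h])) }
  have hpair : ∀ u v : (S : Set V), ∃ c ∈ C,
      G.edgeIncidence.mulVecLin c = Pi.single u.1 1 + Pi.single v.1 1 := by
    intro u v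
    obtain ⟨p⟩ := hS u v
    induction p with
    | nil => exact ⟨0, C.zero_mem, by rw [map_zero]; ext x; exact (ZMod.two_add_self _).symm⟩
    | @cons u w v h p ih =>
      obtain ⟨c, hc, hcM⟩ := ih
      have h' : G.Adj u.1 w.1 := h
      refine ⟨Pi.single ⟨s(u.1, w.1), h'⟩ 1 + c, C.add_mem ?_ hc, ?_⟩
      · intro e he x hx
        have : e = ⟨s(u.1, w.1), h'⟩ := by
          by_contra hne
          exact he (Pi.single_eq_of_ne hne _)
        subst this
        rcases Sym2.mem_iff.1 hx with rfl | rfl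
        exacts [u.2, w.2]
      · rw [map_add, G.edgeIncidence_mulVec_single, hcM]
        ext x
        simp only [Pi.add_apply]
        rw [add_assoc, ← add_assoc (Pi.single w.1 1 x), ZMod.two_add_self, zero_add]
  rcases S.eq_empty_or_nonempty with rfl | ⟨r, hr⟩
  · exact ⟨0, fun e he => absurd rfl he, by rw [map_zero]; ext v; exact (hd v (by simp)).symm⟩
  -- Every vertex of `S` with `d v = 1` is joined to the root `r`. The contributions at `r` add up
  -- to the sum of `d` over `S`, which is zero.
  choose c hcC hcM using fun v : (S : Set V) => hpair v ⟨r, hr⟩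
  refine ⟨∑ v : (S : Set V), d v • c v, C.sum_mem fun v _ => C.smul_mem _ (hcC v), ?_⟩
  rw [map_sum]
  simp_rw [map_smul, hcM, smul_add, Finset.sum_add_distrib]
  rw [← Finset.sum_smul]
  have h1 : ∀ f : V → ZMod 2, ∑ v : (S : Set V), f v = ∑ v ∈ S, f v := fun f =>
    Finset.sum_coe_sort S f
  rw [h1 d, hsum, zero_smul, add_zero]
  ext x
  rw [Finset.sum_apply]
  simp only [Pi.smul_apply, Pi.single_apply, smul_eq_mul, mul_ite, mul_one, mul_zero]
  rw [h1 fun v => if x = v then d v else 0, Finset.sum_ite_eq]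
  split_ifs with h
  · rfl
  · exact (hd x h).symm

/-- The bound on the number of edges of a bipartite planar graph, for the minor obtained by
contracting the members of `𝒜` and keeping, between each of them and each vertex of `B`, at most one
edge. -/
theorem sum_card_adj_add_four_le (G : SimpleGraph V) (hG : HasSparseSpan G.cycleSpace)
    (𝒜 : Finset (Finset V)) (B : Finset V)
    (hdisj : ∀ S ∈ 𝒜, ∀ T ∈ 𝒜, S ≠ T → Disjoint S T) (hB : ∀ S ∈ 𝒜, Disjoint S B)
    (hconn : ∀ S ∈ 𝒜, (G.induce (S : Set V)).Preconnected) (hn : 3 ≤ 𝒜.card + B.card) :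
    ∑ S ∈ 𝒜, (B.filter fun b => ∃ u ∈ S, G.Adj u b).card + 4 ≤ 2 * (𝒜.card + B.card) := by
  let P := {p : {S // S ∈ 𝒜} × {b // b ∈ B} // ∃ u ∈ p.1.1, G.Adj u p.2.1}
  let f : P → {S // S ∈ 𝒜} := fun p => p.1.1
  let g : P → {b // b ∈ B} := fun p => p.1.2
  have hinj : Function.Injective fun p => (f p, g p) := Subtype.val_injective
  have hcardP : Fintype.card P = ∑ S ∈ 𝒜, (B.filter fun b => ∃ u ∈ S, G.Adj u b).card := by
    rw [Fintype.card_subtype, Finset.card_filter, Fintype.sum_prod_type,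
      ← Finset.sum_coe_sort 𝒜]
    refine Finset.sum_congr rfl fun S _ => ?_
    rw [Finset.card_filter, ← Finset.sum_coe_sort B]
  rw [← hcardP, ← Fintype.card_coe 𝒜, ← Fintype.card_coe B]
  refine card_add_four_le_of_hasSparseSpan hinj ?_ (by simpa using hn)
  -- the chosen edges
  choose u huS hu using fun p : P => p.2
  let edge : P → G.edgeSet := fun p => ⟨s(u p, (g p).1), hu p⟩
  have hSB : ∀ S ∈ 𝒜, ∀ v ∈ S, v ∉ B := fun S hS v hv hvB =>
    Finset.disjoint_left.1 (hB S hS) hv hvB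
  have hSS : ∀ S ∈ 𝒜, ∀ T ∈ 𝒜, ∀ v ∈ S, v ∈ T → S = T := fun S hS T hT v hv hvT => by
    by_contra h
    exact Finset.disjoint_left.1 (hdisj S hS T hT h) hv hvT
  have huf : ∀ p S, S ∈ 𝒜 → u p ∈ S → f p = S := fun p S hS h =>
    hSS _ (f p).2 _ hS (u p) (huS p) h
  have hedge : Function.Injective edge := by
    intro p q h
    have h := congrArg Subtype.val h
    rcases Sym2.eq_iff.1 h with ⟨h1, h2⟩ | ⟨h1, h2⟩
    · apply hinj
      refine Prod.ext (Subtype.ext ?_) (Subtype.ext h2)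
      exact huf p _ (f q).2 (h1 ▸ huS q)
    · exact absurd (g q).2 (h1 ▸ hSB _ (f p).2 _ (huS p))
  let inner : G.edgeSet → Prop := fun e => ∃ S ∈ 𝒜, ∀ v ∈ e.1, v ∈ S
  have hinner : ∀ p, ¬ inner (edge p) := by
    rintro p ⟨S, hS, h⟩
    exact hSB S hS _ (h _ (Sym2.mem_mk_right _ _)) (g p).2
  -- The edges in `D` are deleted and the inner edges are contracted, so only the chosen edges
  -- remain as coordinates.
  let D : Finset G.edgeSet := Finset.univ.filter fun e => e ∉ Set.range edge ∧ ¬ inner e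
  have hZ := (hG.inf_vanishing D).map_funLeft edge
  have hDmem : ∀ z : G.edgeSet → ZMod 2, (z ∈ ⨅ e ∈ D,
      LinearMap.ker (LinearMap.proj (R := ZMod 2) (φ := fun _ : G.edgeSet => ZMod 2) e)) ↔
      ∀ e, e ∉ Set.range edge → ¬ inner e → z e = 0 := by
    intro z
    simp [Submodule.mem_iInf, D]
  -- degree sums over a vertex set that contains both or no end of every inner edge
  have hdeg : ∀ (Y : Finset V) (z : G.edgeSet → ZMod 2),
      (∀ e, e ∉ Set.range edge → ¬ inner e → z e = 0) →
      (∀ e, inner e → ∑ v ∈ Y, (if v ∈ e.1 then z e else 0) = 0) →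
      ∑ v ∈ Y, G.edgeIncidence.mulVecLin z v =
        ∑ p, ∑ v ∈ Y, if v ∈ (edge p).1 then z (edge p) else 0 := by
    intro Y z hz hY
    simp_rw [G.edgeIncidence_mulVec]
    rw [Finset.sum_comm, ← Finset.sum_image (s := (Finset.univ : Finset P)) (g := edge)
      (f := fun e => ∑ v ∈ Y, if v ∈ e.1 then z e else 0) hedge.injOn]
    symm
    refine Finset.sum_subset (Finset.subset_univ _) fun e _ he => ?_
    have he : e ∉ Set.range edge := by simpa using he
    by_cases hi : inner e
    · exact hY e hi
    · simp [hz e he hi]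
  have hS_inner : ∀ S ∈ 𝒜, ∀ (z : G.edgeSet → ZMod 2) (e), inner e →
      ∑ v ∈ S, (if v ∈ e.1 then z e else 0) = 0 := by
    rintro S hS z ⟨e, he⟩ ⟨T, hT, heT⟩
    induction e with
    | h a b =>
    have hab : a ≠ b := G.ne_of_adj he
    have ha := heT a (Sym2.mem_mk_left _ _)
    have hb := heT b (Sym2.mem_mk_right _ _)
    by_cases hST : S = T
    · subst hST
      rw [← Finset.sum_filter]
      have : (S.filter fun v => v ∈ s(a, b)) = {a, b} := by
        ext v; simp only [Finset.mem_filter, Sym2.mem_iff, Finset.mem_insert, Finset.mem_singleton]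
        constructor
        · exact fun h => h.2
        · rintro (rfl | rfl) <;> simp [ha, hb]
      rw [this, Finset.sum_pair hab]
      exact ZMod.two_add_self _
    · refine Finset.sum_eq_zero fun v hv => if_neg fun h => hST ?_
      exact hSS S hS T hT v hv (heT v h)
  have hB_inner : ∀ b ∈ B, ∀ (z : G.edgeSet → ZMod 2) (e), inner e →
      ∑ v ∈ ({b} : Finset V), (if v ∈ e.1 then z e else 0) = 0 := by
    rintro b hb z e ⟨T, hT, heT⟩
    rw [Finset.sum_singleton, if_neg]
    exact fun h => hSB T hT b (heT b h) hb
  have hS_edge : ∀ (S : {S // S ∈ 𝒜}) (p : P) (r : ZMod 2),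
      (∑ v ∈ S.1, if v ∈ (edge p).1 then r else 0) = if f p = S then r else 0 := by
    intro S p r
    have hb : (g p).1 ∉ S.1 := fun h => hSB _ S.2 _ h (g p).2
    split_ifs with h
    · rw [Finset.sum_eq_single (u p)]
      · rw [if_pos (Sym2.mem_mk_left _ _)]
      · intro v hv hne
        rw [if_neg]
        intro h'
        rcases Sym2.mem_iff.1 h' with rfl | rfl
        exacts [hne rfl, hb hv]
      · intro h'; exact absurd (h ▸ huS p) h'
    · refine Finset.sum_eq_zero fun v hv => if_neg fun h' => ?_
      rcases Sym2.mem_iff.1 h' with rfl | rfl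
      · exact h (Subtype.ext (huf p _ S.2 hv))
      · exact hb hv
  have hB_edge : ∀ (b : {b // b ∈ B}) (p : P) (r : ZMod 2),
      (∑ v ∈ ({b.1} : Finset V), if v ∈ (edge p).1 then r else 0) = if g p = b then r else 0 := by
    intro b p r
    rw [Finset.sum_singleton]
    refine if_congr ?_ rfl rfl
    constructor
    · intro h
      rcases Sym2.mem_iff.1 h with h | h
      · exact absurd b.2 (h ▸ hSB _ (f p).2 _ (huS p))
      · exact Subtype.ext h.symm
    · rintro rfl; exact Sym2.mem_mk_right _ _
  convert hZ using 1
  apply le_antisymm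
  -- A cycle of the minor is extended by zero to `z₀`. Its odd-degree vertices lie in members of
  -- `𝒜`, an even number in each. As these are connected, inner edges can repair the parity, and
  -- they do not change the chosen coordinates.
  · intro y hy
    obtain ⟨hy1, hy2⟩ := mem_ker_bipartiteBoundary.1 hy
    let z₀ : G.edgeSet → ZMod 2 := Function.extend edge y 0
    have hz₀e : ∀ p, z₀ (edge p) = y p := fun p => hedge.extend_apply _ _ p
    have hz₀ : ∀ e, e ∉ Set.range edge → z₀ e = 0 := fun e he =>
      Function.extend_apply' _ _ _ he
    let d := G.edgeIncidence.mulVecLin z₀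
    have hdS : ∀ S ∈ 𝒜, ∑ v ∈ S, d v = 0 := by
      intro S hS
      rw [hdeg S z₀ (fun e he _ => hz₀ e he) (hS_inner S hS z₀)]
      refine Eq.trans ?_ (hy1 ⟨S, hS⟩)
      exact Finset.sum_congr rfl fun p _ => by
        rw [← hz₀e p]; convert hS_edge ⟨S, hS⟩ p (z₀ (edge p))
    have hdB : ∀ b ∈ B, d b = 0 := by
      intro b hb
      rw [← Finset.sum_singleton d b, hdeg {b} z₀ (fun e he _ => hz₀ e he) (hB_inner b hb z₀)]
      refine Eq.trans ?_ (hy2 ⟨b, hb⟩)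
      exact Finset.sum_congr rfl fun p _ => by
        rw [← hz₀e p]; convert hB_edge ⟨b, hb⟩ p (z₀ (edge p))
    have hd0 : ∀ v, (∀ S ∈ 𝒜, v ∉ S) → d v = 0 := by
      intro v hv
      by_cases hvB : v ∈ B
      · exact hdB v hvB
      · change G.edgeIncidence.mulVecLin z₀ v = 0
        rw [G.edgeIncidence_mulVec]
        refine Finset.sum_eq_zero fun e _ => ?_
        split_ifs with hve
        · apply hz₀
          rintro ⟨p, rfl⟩
          rcases Sym2.mem_iff.1 hve with rfl | rfl
          · exact hv _ (f p).2 (huS p)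
          · exact hvB (g p).2
        · rfl
    choose c hcS hcM using fun S : {S // S ∈ 𝒜} =>
      G.exists_edgeIncidence_mulVec_eq S.1 (hconn S.1 S.2)
        (fun v => if v ∈ S.1 then d v else 0) (fun v hv => if_neg hv)
        (by rw [Finset.sum_ite_mem, Finset.inter_self]; exact hdS S.1 S.2)
    have hc0 : ∀ S p, c S (edge p) = 0 := by
      intro S p
      by_contra h
      exact hinner p ⟨S.1, S.2, hcS S _ h⟩
    refine ⟨z₀ + ∑ S, c S, ⟨?_, ?_⟩, ?_⟩
    · refine LinearMap.mem_ker.2 ?_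
      rw [map_add, map_sum]
      simp_rw [hcM]
      ext v
      rw [Pi.add_apply, Finset.sum_apply]
      change d v + ∑ S : {S // S ∈ 𝒜}, (if v ∈ S.1 then d v else 0) = 0
      by_cases hv : ∃ S ∈ 𝒜, v ∈ S
      · obtain ⟨S, hS, hvS⟩ := hv
        rw [Finset.sum_eq_single ⟨S, hS⟩, if_pos hvS]
        · exact ZMod.two_add_self _
        · intro T _ hT
          rw [if_neg]
          intro hvT; exact hT (Subtype.ext (hSS _ T.2 _ hS v hvT hvS))
        · simp
      · push Not at hv
        rw [hd0 v hv]; simp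
    · rw [SetLike.mem_coe, hDmem]
      intro e he hi
      rw [Pi.add_apply, Finset.sum_apply, hz₀ e he, zero_add]
      refine Finset.sum_eq_zero fun S _ => ?_
      by_contra h
      exact hi ⟨S.1, S.2, hcS S _ h⟩
    · ext p
      change (z₀ + ∑ S, c S) (edge p) = y p
      rw [Pi.add_apply, Finset.sum_apply, hz₀e, Finset.sum_eq_zero fun S _ => hc0 S p, add_zero]
  -- Conversely, in the sum of the degrees over a member of `𝒜` each inner edge counts twice or not
  -- at all, so only the chosen edges contribute.
  · rintro _ ⟨z, ⟨hzc, hzD⟩, rfl⟩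
    rw [SetLike.mem_coe, hDmem] at hzD
    have hM : ∀ v, G.edgeIncidence.mulVecLin z v = 0 := fun v =>
      congrFun (LinearMap.mem_ker.1 hzc) v
    refine mem_ker_bipartiteBoundary.2 ⟨fun S => ?_, fun b => ?_⟩
    · have h := hdeg S.1 z hzD (hS_inner S.1 S.2 z)
      rw [Finset.sum_eq_zero fun v _ => hM v] at h
      refine Eq.trans ?_ h.symm
      exact Finset.sum_congr rfl fun p _ =>
        by convert (hS_edge S p (z (edge p))).symm; rfl
    · have h := hdeg {b.1} z hzD (hB_inner b.1 b.2 z)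
      rw [Finset.sum_eq_zero fun v _ => hM v] at h
      refine Eq.trans ?_ h.symm
      exact Finset.sum_congr rfl fun p _ =>
        by convert (hB_edge b p (z (edge p))).symm; rfl

end Minor

/-! ### Splitting at cut vertices and the average degree of the terminal sets -/

section CutVertices

open scoped Classical

variable {V : Type*}

namespace SimpleGraph

theorem reachable_deleteIncidenceSet_of_walk {H : SimpleGraph V} {x u v : V} (p : H.Walk u v)
    (hx : x ∉ p.support) : (H.deleteIncidenceSet x).Reachable u v := by
  induction p with
  | nil => exact Reachable.refl _
  | @cons u w v h p ih =>
    rw [Walk.support_cons, List.mem_cons, not_or] at hx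
    have hw : w ≠ x := fun hw => hx.2 (hw ▸ p.start_mem_support)
    have : (H.deleteIncidenceSet x).Adj u w := H.deleteIncidenceSet_adj.2 ⟨h, Ne.symm hx.1, hw⟩
    exact this.reachable.trans (ih hx.2)

/-- A path from `y` to `t` avoids `x`, or its part after `x` avoids its starting point `y`. -/
theorem reachable_deleteIncidenceSet_or {H : SimpleGraph V} {x y t : V} (hxy : x ≠ y)
    (h : H.Reachable y t) : (H.deleteIncidenceSet x).Reachable y t ∨
      (H.deleteIncidenceSet y).Reachable x t ∧ H.Reachable y x := by
  obtain ⟨p, hp⟩ := h.exists_isPath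
  by_cases hx : x ∈ p.support
  · right
    refine ⟨reachable_deleteIncidenceSet_of_walk (p.dropUntil x hx) fun hy => ?_,
      ⟨p.takeUntil x hx⟩⟩
    have hnd := hp.support_nodup
    rw [← p.take_spec hx, Walk.support_append, List.nodup_append] at hnd
    rw [← Walk.cons_tail_support, List.mem_cons] at hy
    exact hnd.2.2 y (Walk.start_mem_support _) y (hy.resolve_left (Ne.symm hxy)) rfl
  · exact Or.inl (reachable_deleteIncidenceSet_of_walk p hx)

theorem exists_adj_of_reachable {H : SimpleGraph V} {x y : V} (hxy : y ≠ x)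
    (h : H.Reachable y x) : ∃ c, H.Adj c x ∧ (H.deleteIncidenceSet x).Reachable y c := by
  obtain ⟨p⟩ := h
  induction p with
  | nil => exact absurd rfl hxy
  | @cons u w v h p ih =>
    by_cases hw : w = v
    · subst hw; exact ⟨u, h, Reachable.refl _⟩
    · obtain ⟨c, hc, hr⟩ := ih hw
      have : (H.deleteIncidenceSet v).Adj u w := H.deleteIncidenceSet_adj.2 ⟨h, hxy, hw⟩
      exact ⟨c, hc, this.reachable.trans hr⟩

/-- The edges with an end in `D`. -/
def edgesTouching (H : SimpleGraph V) (D : Set V) : SimpleGraph V where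
  Adj u v := H.Adj u v ∧ (u ∈ D ∨ v ∈ D)
  symm := ⟨fun _ _ h => ⟨h.1.symm, h.2.symm⟩⟩
  loopless := ⟨fun _ h => h.1.ne rfl⟩

theorem edgesTouching_le (H : SimpleGraph V) (D : Set V) : H.edgesTouching D ≤ H :=
  fun _ _ h => h.1

theorem reachable_edgesTouching {H : SimpleGraph V} {D : Set V} {x u v : V}
    (hD : ∀ u v, (H.deleteIncidenceSet x).Adj u v → u ∈ D → v ∈ D) (hu : u ∈ D)
    (h : (H.deleteIncidenceSet x).Reachable u v) :
    v ∈ D ∧ (H.edgesTouching D).Reachable u v := by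
  obtain ⟨p⟩ := h
  induction p with
  | nil => exact ⟨hu, Reachable.refl _⟩
  | @cons u w v h p ih =>
    obtain ⟨h1, h2⟩ := ih (hD _ _ h hu)
    have : (H.edgesTouching D).Adj u w := ⟨(H.deleteIncidenceSet_adj.1 h).1, Or.inl hu⟩
    exact ⟨h1, this.reachable.trans h2⟩

theorem reachable_deleteIncidenceSet_of_induce {H : SimpleGraph V} {S : Set V} {x : V}
    (hS : (H.induce S).Preconnected) (hx : x ∉ S) {u v : V} (hu : u ∈ S) (hv : v ∈ S) :
    (H.deleteIncidenceSet x).Reachable u v := by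
  let φ : H.induce S →g H.deleteIncidenceSet x :=
    ⟨Subtype.val, fun {a b} h => H.deleteIncidenceSet_adj.2
      ⟨h, fun h' => hx (h' ▸ a.2), fun h' => hx (h' ▸ b.2)⟩⟩
  exact (hS ⟨u, hu⟩ ⟨v, hv⟩).map φ

/-- Two vertices of `T` in the component of `x` lie in different components once `x` is removed. -/
def IsCutVertexFor (H : SimpleGraph V) (T : Set V) (x : V) : Prop :=
  ∃ t₁ ∈ T, ∃ t₂ ∈ T, H.Reachable x t₁ ∧ H.Reachable x t₂ ∧
    ¬ (H.deleteIncidenceSet x).Reachable t₁ t₂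

theorem deleteIncidenceSet_mono_left {H K : SimpleGraph V} (h : H ≤ K) (x : V) :
    H.deleteIncidenceSet x ≤ K.deleteIncidenceSet x := by
  intro u v huv
  rw [deleteIncidenceSet_adj] at huv ⊢
  exact ⟨h huv.1, huv.2⟩

/-- A cut vertex in a union `D` of components of `H - x` is one of `H[D ∪ {x}]` when `x` is regarded
as a terminal. -/
theorem IsCutVertexFor.edgesTouching {H : SimpleGraph V} {T D : Set V} {x y : V}
    (h : H.IsCutVertexFor T y) (hy : y ∈ D) (hx : x ∉ D)
    (hD : ∀ u v, (H.deleteIncidenceSet x).Adj u v → u ∈ D → v ∈ D) :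
    (H.edgesTouching D).IsCutVertexFor {t | t = x ∨ t ∈ D ∧ t ∈ T} y := by
  obtain ⟨t, ht, t', ht', hr, hr', hne⟩ := h
  have hxy : x ≠ y := fun h => hx (h ▸ hy)
  have hmono : ∀ a b, ¬ (H.deleteIncidenceSet y).Reachable a b →
      ¬ ((H.edgesTouching D).deleteIncidenceSet y).Reachable a b := fun a b h h' =>
    h (h'.mono (deleteIncidenceSet_mono_left (H.edgesTouching_le D) y))
  have hyx : H.Reachable y x → (H.edgesTouching D).Reachable y x := by
    intro h
    obtain ⟨c, hc, hyc⟩ := exists_adj_of_reachable hxy.symm h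
    obtain ⟨hcD, hyc⟩ := reachable_edgesTouching hD hy hyc
    have : (H.edgesTouching D).Adj c x := ⟨hc, Or.inl hcD⟩
    exact hyc.trans this.reachable
  rcases reachable_deleteIncidenceSet_or hxy hr with h1 | ⟨h1, h1'⟩ <;>
  rcases reachable_deleteIncidenceSet_or hxy hr' with h2 | ⟨h2, h2'⟩
  · obtain ⟨h3, h3'⟩ := reachable_edgesTouching hD hy h1
    obtain ⟨h4, h4'⟩ := reachable_edgesTouching hD hy h2
    exact ⟨t, Or.inr ⟨h3, ht⟩, t', Or.inr ⟨h4, ht'⟩, h3', h4', hmono _ _ hne⟩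
  · obtain ⟨h3, h3'⟩ := reachable_edgesTouching hD hy h1
    exact ⟨t, Or.inr ⟨h3, ht⟩, x, Or.inl rfl, h3', hyx h2', hmono _ _ fun h => hne (h.trans h2)⟩
  · obtain ⟨h4, h4'⟩ := reachable_edgesTouching hD hy h2
    exact ⟨x, Or.inl rfl, t', Or.inr ⟨h4, ht'⟩, hyx h1', h4',
      hmono _ _ fun h => hne (h1.symm.trans h)⟩
  · exact absurd (h1.symm.trans h2) hne

/-- The number of vertices of `Y` that are adjacent to a vertex of `S`. -/
noncomputable def adjCount (H : SimpleGraph V) (S Y : Finset V) : ℕ :=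
  (Y.filter fun b => ∃ u ∈ S, H.Adj u b).card

variable [Fintype V]

/-- From three vertices on, this is the bipartite planar bound for the contracted graph. With two,
the bound $2n-4=0$ fails for one set adjacent to one vertex; the extra 1 for degree one absorbs
exactly this case. -/
theorem sum_adjCount_add_four_le_of_no_cut {G H : SimpleGraph V} (hG : HasSparseSpan G.cycleSpace)
    (hHG : H ≤ G) (𝒜 : Finset (Finset V)) (B : Finset V)
    (hdisj : ∀ S ∈ 𝒜, ∀ T ∈ 𝒜, S ≠ T → Disjoint S T) (hB : ∀ S ∈ 𝒜, Disjoint S B)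
    (hconn : ∀ S ∈ 𝒜, (H.induce (S : Set V)).Preconnected) (hn : 2 ≤ 𝒜.card + B.card) :
    ∑ S ∈ 𝒜, H.adjCount S B + 4 ≤
      ∑ S ∈ 𝒜, (2 + if H.adjCount S B = 1 then 1 else 0) + 2 * B.card := by
  have hlow : 𝒜.card * 2 ≤ ∑ S ∈ 𝒜, (2 + if H.adjCount S B = 1 then 1 else 0) :=
    Finset.card_nsmul_le_sum _ _ _ fun S _ => Nat.le_add_right _ _
  rcases Nat.lt_or_ge 2 (𝒜.card + B.card) with h3 | h3
  · have h1 := sum_card_adj_add_four_le G hG 𝒜 B hdisj hB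
      (fun S hS => (hconn S hS).mono fun _ _ h => hHG h) h3
    have h2 : ∑ S ∈ 𝒜, H.adjCount S B ≤
        ∑ S ∈ 𝒜, (B.filter fun b => ∃ u ∈ S, G.Adj u b).card :=
      Finset.sum_le_sum fun S _ => Finset.card_le_card
        (Finset.monotone_filter_right B fun b _ ⟨u, hu, hub⟩ => ⟨u, hu, hHG hub⟩)
    omega
  · rcases Nat.lt_or_ge 0 B.card with hBc | hBc
    · rcases Nat.lt_or_ge 0 𝒜.card with hAc | hAc
      · obtain ⟨S, rfl⟩ := Finset.card_eq_one.1 (show 𝒜.card = 1 by omega)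
        have : H.adjCount S B ≤ B.card := Finset.card_filter_le _ _
        have h1 : B.card = 1 := by rw [Finset.card_singleton] at *; omega
        rw [Finset.sum_singleton, Finset.sum_singleton]
        split_ifs <;> omega
      · have : 𝒜 = ∅ := Finset.card_eq_zero.1 (by omega)
        subst this
        simp at hn ⊢
        omega
    · have hB0 : B = ∅ := Finset.card_eq_zero.1 (by omega)
      have : ∑ S ∈ 𝒜, H.adjCount S B = 0 :=
        Finset.sum_eq_zero fun S _ => by simp [adjCount, hB0]
      omega

theorem sum_adjCount_add_four_le {G : SimpleGraph V} (hG : HasSparseSpan G.cycleSpace)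
    (H : SimpleGraph V) (hHG : H ≤ G) (𝒜 : Finset (Finset V)) (B X : Finset V)
    (hdisj : ∀ S ∈ 𝒜, ∀ T ∈ 𝒜, S ≠ T → Disjoint S T) (hne : ∀ S ∈ 𝒜, S.Nonempty)
    (hB : ∀ S ∈ 𝒜, Disjoint S (X ∪ B)) (hBX : Disjoint X B)
    (hconn : ∀ S ∈ 𝒜, (H.induce (S : Set V)).Preconnected)
    (hX : ∀ x ∈ X, H.IsCutVertexFor {t | t ∈ B ∨ ∃ S ∈ 𝒜, t ∈ S} x)
    (hn : 2 ≤ 𝒜.card + B.card) :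
    ∑ S ∈ 𝒜, H.adjCount S (X ∪ B) + 4 ≤
      ∑ S ∈ 𝒜, (2 + if H.adjCount S (X ∪ B) = 1 then 1 else 0) + 2 * B.card := by
  induction hc : X.card using Nat.strong_induction_on generalizing H 𝒜 B X with
  | _ n ih =>
  rcases X.eq_empty_or_nonempty with rfl | ⟨x, hx⟩
  · simp only [Finset.empty_union] at hB ⊢
    exact sum_adjCount_add_four_le_of_no_cut hG hHG 𝒜 B hdisj hB hconn hn
  have hxS : ∀ S ∈ 𝒜, x ∉ S := fun S hS h =>
    Finset.disjoint_left.1 (hB S hS) h (Finset.mem_union_left _ hx)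
  have hxB : x ∉ B := Finset.disjoint_left.1 hBX hx
  let T : Set V := {t | t ∈ B ∨ ∃ S ∈ 𝒜, t ∈ S}
  have hSD : ∀ D : Set V, (∀ u v, (H.deleteIncidenceSet x).Adj u v → u ∈ D → v ∈ D) →
      ∀ S ∈ 𝒜, ∀ u ∈ S, u ∈ D → ∀ v ∈ S, v ∈ D := by
    intro D hD S hS u hu huD v hv
    exact (reachable_edgesTouching hD huD
      (reachable_deleteIncidenceSet_of_induce (hconn S hS) (by simpa using hxS S hS) hu hv)).1
  have side : ∀ D : Set V, x ∉ D →
      (∀ u v, (H.deleteIncidenceSet x).Adj u v → u ∈ D → v ∈ D) → (∃ t ∈ T, t ∈ D) →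
      ∑ S ∈ 𝒜 with ∀ v ∈ S, v ∈ D, H.adjCount S (X ∪ B) + 4 ≤
        ∑ S ∈ 𝒜 with ∀ v ∈ S, v ∈ D, (2 + if H.adjCount S (X ∪ B) = 1 then 1 else 0) +
          2 * ((B.filter (· ∈ D)).card + 1) := by
    intro D hxD hD hT
    -- All neighbours of a set inside `D` lie in `D` or equal `x`, so its degree, and with it the
    -- degree-one term, is the same on its side as in `H`.
    have hcount : ∀ S : Finset V, (∀ v ∈ S, v ∈ D) →
        (H.edgesTouching D).adjCount S (X.filter (· ∈ D) ∪ insert x (B.filter (· ∈ D))) =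
          H.adjCount S (X ∪ B) := by
      intro S hS
      unfold adjCount
      congr 1
      ext b
      simp only [Finset.mem_filter, Finset.mem_union, Finset.mem_insert]
      constructor
      · rintro ⟨hb, u, hu, hub⟩
        refine ⟨?_, u, hu, hub.1⟩
        rcases hb with hb | rfl | hb
        exacts [Or.inl hb.1, Or.inl hx, Or.inr hb.1]
      · rintro ⟨hb, u, hu, hub⟩
        refine ⟨?_, u, hu, hub, Or.inl (hS u hu)⟩
        by_cases hbx : b = x
        · exact Or.inr (Or.inl hbx)
        · have hux : u ≠ x := fun h => hxD (h ▸ hS u hu)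
          have hbD := hD u b (H.deleteIncidenceSet_adj.2 ⟨hub, hux, hbx⟩) (hS u hu)
          exact hb.imp (fun h => ⟨h, hbD⟩) fun h => Or.inr ⟨h, hbD⟩
    have hlt : (X.filter (· ∈ D)).card < n := by
      rw [← hc]
      refine Finset.card_lt_card (Finset.filter_ssubset.2 ⟨x, hx, hxD⟩)
    have hcardB : (insert x (B.filter (· ∈ D))).card = (B.filter (· ∈ D)).card + 1 :=
      Finset.card_insert_of_notMem fun h => hxD (Finset.mem_filter.1 h).2
    have key := ih _ hlt (H.edgesTouching D) ((H.edgesTouching_le D).trans hHG)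
      (𝒜.filter fun S => ∀ v ∈ S, v ∈ D) (insert x (B.filter (· ∈ D))) (X.filter (· ∈ D))
      (fun S hS T hT => hdisj S (Finset.mem_filter.1 hS).1 T (Finset.mem_filter.1 hT).1)
      (fun S hS => hne S (Finset.mem_filter.1 hS).1)
      (fun S hS => (hB S (Finset.mem_filter.1 hS).1).mono_right (by
        intro b
        simp only [Finset.mem_filter, Finset.mem_union, Finset.mem_insert]
        rintro (h | rfl | h)
        exacts [Or.inl h.1, Or.inl hx, Or.inr h.1]))
      (by
        rw [Finset.disjoint_insert_right]
        exact ⟨fun h => hxD (Finset.mem_filter.1 h).2,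
          hBX.mono (Finset.filter_subset _ _) (Finset.filter_subset _ _)⟩)
      (fun S hS => (hconn S (Finset.mem_filter.1 hS).1).mono fun a b h =>
        ⟨h, Or.inl ((Finset.mem_filter.1 hS).2 a.1 a.2)⟩)
      (fun y hy => by
        obtain ⟨hyX, hyD⟩ := Finset.mem_filter.1 hy
        obtain ⟨t, ht, t', ht', h⟩ := (hX y hyX).edgesTouching hyD hxD hD
        have hsub : ∀ t, t ∈ {t | t = x ∨ t ∈ D ∧ t ∈ T} →
            t ∈ {t | t ∈ insert x (B.filter (· ∈ D)) ∨
              ∃ S ∈ 𝒜.filter (fun S => ∀ v ∈ S, v ∈ D), t ∈ S} := by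
          rintro t (rfl | ⟨htD, htB | ⟨S, hS, htS⟩⟩)
          · exact Or.inl (Finset.mem_insert_self _ _)
          · exact Or.inl (Finset.mem_insert_of_mem (Finset.mem_filter.2 ⟨htB, htD⟩))
          · exact Or.inr ⟨S, Finset.mem_filter.2 ⟨hS, hSD D hD S hS t htS htD⟩, htS⟩
        exact ⟨t, hsub t ht, t', hsub t' ht', h⟩)
      (by
        rw [hcardB]
        obtain ⟨t, htB | ⟨S, hS, htS⟩, htD⟩ := hT
        · have : 0 < (B.filter (· ∈ D)).card :=
            Finset.card_pos.2 ⟨t, Finset.mem_filter.2 ⟨htB, htD⟩⟩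
          omega
        · have : 0 < (𝒜.filter fun S => ∀ v ∈ S, v ∈ D).card :=
            Finset.card_pos.2 ⟨S, Finset.mem_filter.2 ⟨hS, hSD D hD S hS t htS htD⟩⟩
          omega)
      rfl
    rw [hcardB] at key
    refine le_trans (le_of_eq ?_) (key.trans (le_of_eq ?_))
    · congr 1
      exact Finset.sum_congr rfl fun S hS => (hcount S (Finset.mem_filter.1 hS).2).symm
    · congr 1
      exact Finset.sum_congr rfl fun S hS => by rw [hcount S (Finset.mem_filter.1 hS).2]
  obtain ⟨t₁, ht₁, t₂, ht₂, -, -, hsep⟩ := hX x hx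
  have hTx : ∀ t ∈ T, t ≠ x := by
    rintro t (ht | ⟨S, hS, ht⟩) rfl
    exacts [hxB ht, hxS S hS ht]
  obtain ⟨C, hC⟩ : ∃ C : Set V, ∀ v, v ∈ C ↔ (H.deleteIncidenceSet x).Reachable t₁ v :=
    ⟨_, fun _ => Iff.rfl⟩
  have hCadj : ∀ u v, (H.deleteIncidenceSet x).Adj u v → u ∈ C → v ∈ C :=
    fun u v h hu => (hC v).2 (((hC u).1 hu).trans h.reachable)
  have hxC : x ∉ C := by
    rintro h
    obtain ⟨c, hc, -⟩ :=
      exists_adj_of_reachable (H := H.deleteIncidenceSet x) (hTx t₁ ht₁) ((hC x).1 h)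
    exact (H.deleteIncidenceSet_adj.1 hc).2.2 rfl
  obtain ⟨D, hD⟩ : ∃ D : Set V, ∀ v, v ∈ D ↔ v ≠ x ∧ v ∉ C := ⟨_, fun _ => Iff.rfl⟩
  have h1 := side C hxC hCadj ⟨t₁, ht₁, (hC t₁).2 (Reachable.refl _)⟩
  have h2 := side D (fun h => ((hD x).1 h).1 rfl)
    (fun u v h hu => (hD v).2 ⟨(H.deleteIncidenceSet_adj.1 h).2.2,
      fun hv => ((hD u).1 hu).2 (hCadj v u h.symm hv)⟩)
    ⟨t₂, ht₂, (hD t₂).2 ⟨hTx t₂ ht₂, fun h => hsep ((hC t₂).1 h)⟩⟩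
  have hfA : (𝒜.filter fun S => ∀ v ∈ S, v ∈ D) = 𝒜.filter fun S => ¬ ∀ v ∈ S, v ∈ C := by
    refine Finset.filter_congr fun S hS =>
      ⟨fun h h' => ?_, fun h v hv => (hD v).2 ⟨?_, fun hvC => ?_⟩⟩
    · obtain ⟨v, hv⟩ := hne S hS
      exact ((hD v).1 (h v hv)).2 (h' v hv)
    · rintro rfl; exact hxS S hS hv
    · exact h (hSD C hCadj S hS v hv hvC)
  have hfB : (B.filter (· ∈ D)) = B.filter fun v => ¬ v ∈ C :=
    Finset.filter_congr fun v hv =>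
      ⟨fun h => ((hD v).1 h).2, fun h => (hD v).2 ⟨by rintro rfl; exact hxB hv, h⟩⟩
  rw [hfA, hfB] at h2
  have h3 := Finset.card_filter_add_card_filter_not (s := B) (· ∈ C)
  have h4 := Finset.sum_filter_add_sum_filter_not 𝒜 (fun S => ∀ v ∈ S, v ∈ C)
    fun S => H.adjCount S (X ∪ B)
  have h5 := Finset.sum_filter_add_sum_filter_not 𝒜 (fun S => ∀ v ∈ S, v ∈ C)
    fun S => (2 + if H.adjCount S (X ∪ B) = 1 then 1 else 0)
  -- Counting `x` in `B` on both sides costs $2\cdot 2=4$, and this is paid for by the second of the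
  -- two summands 4 on the left.
  omega

end SimpleGraph

end CutVertices

/-! ### Analysis of the primal-dual algorithm -/

namespace PCSF

open scoped Classical

variable {V : Type*} {I : PCSF V}

/-! #### Connectivity inside vertex sets -/

section Connectivity

theorem mem_boughtSet {s : PCSFState V} {v : V} : v ∈ boughtSet s ↔ v ∈ s.bought := by
  simp [boughtSet]

theorem ConnectedVia.mono {F F' : Finset V} (h : F ⊆ F') {p : V × V} (hp : I.ConnectedVia F p) :
    I.ConnectedVia F' p := by
  obtain ⟨h₁, h₂, hr⟩ := hp
  refine ⟨h h₁, h h₂, ?_⟩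
  exact hr.map (SimpleGraph.induceHomOfLE I.G (Finset.coe_subset.2 h)).toHom

theorem ConnectedVia.symm {F : Finset V} {u v : V} (h : I.ConnectedVia F (u, v)) :
    I.ConnectedVia F (v, u) :=
  let ⟨h₁, h₂, hr⟩ := h
  ⟨h₂, h₁, hr.symm⟩

/-- The edges of the graph that join two vertices of `W`. -/
def edgesWithin (I : PCSF V) (W : Finset V) : SimpleGraph V where
  Adj u v := I.G.Adj u v ∧ u ∈ W ∧ v ∈ W
  symm := ⟨fun _ _ h => ⟨h.1.symm, h.2.2, h.2.1⟩⟩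
  loopless := ⟨fun _ h => h.1.ne rfl⟩

theorem ConnectedVia.reachable_edgesWithin {W : Finset V} {p : V × V} (h : I.ConnectedVia W p) :
    (I.edgesWithin W).Reachable p.1 p.2 := by
  obtain ⟨h₁, h₂, hr⟩ := h
  let φ : I.G.induce (W : Set V) →g I.edgesWithin W :=
    ⟨Subtype.val, fun {a b} h => ⟨h, a.2, b.2⟩⟩
  exact hr.map φ

theorem connectedVia_erase_of_reachable {W : Finset V} {x u v : V} (hu : u ∈ W) (hux : u ≠ x)
    (h : ((I.edgesWithin W).deleteIncidenceSet x).Reachable u v) :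
    I.ConnectedVia (W.erase x) (u, v) := by
  obtain ⟨p⟩ := h
  induction p with
  | nil => exact ⟨Finset.mem_erase.2 ⟨hux, hu⟩, Finset.mem_erase.2 ⟨hux, hu⟩, .refl _⟩
  | @cons u w v h p ih =>
    obtain ⟨⟨hG, -, hwW⟩, -, hwx⟩ := SimpleGraph.deleteIncidenceSet_adj.1 h
    obtain ⟨h₁, h₂, hr⟩ := ih hwW hwx
    have h₀ : u ∈ W.erase x := Finset.mem_erase.2 ⟨hux, hu⟩
    have hadj : (I.G.induce ((W.erase x : Finset V) : Set V)).Adj ⟨u, h₀⟩ ⟨w, h₁⟩ := hG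
    exact ⟨h₀, h₂, hadj.reachable.trans hr⟩

end Connectivity

/-! #### Moats -/

section Moats

variable {s : PCSFState V} {S T : Finset V}

theorem IsMoat.mem_iff (h : I.IsMoat s S) {u : V} (hu : u ∈ S) {v : V} :
    v ∈ S ↔ I.ConnectedVia (boughtSet s) (u, v) := by
  obtain ⟨c, hc⟩ := h
  have hmem : ∀ v, v ∈ S ↔ ∃ h : v ∈ boughtSet s,
      (I.G.induce (boughtSet s : Set V)).connectedComponentMk ⟨v, h⟩ = c := by
    intro v
    rw [← Finset.mem_coe, hc]
    constructor
    · rintro ⟨⟨w, hw⟩, hwc, rfl⟩; exact ⟨hw, hwc⟩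
    · rintro ⟨hv, h⟩; exact ⟨⟨v, hv⟩, h, rfl⟩
  obtain ⟨huF, huc⟩ := (hmem u).1 hu
  rw [hmem]
  constructor
  · rintro ⟨hvF, hvc⟩
    exact ⟨huF, hvF, SimpleGraph.ConnectedComponent.eq.1 (huc.trans hvc.symm)⟩
  · rintro ⟨_, hvF, hr⟩
    exact ⟨hvF, (SimpleGraph.ConnectedComponent.eq.2 hr.symm).trans huc⟩

theorem IsMoat.nonempty (h : I.IsMoat s S) : S.Nonempty := by
  obtain ⟨c, hc⟩ := h
  obtain ⟨v, hv⟩ := c.nonempty_supp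
  exact ⟨v.1, by rw [← Finset.mem_coe, hc]; exact ⟨v, hv, rfl⟩⟩

theorem IsMoat.subset (h : I.IsMoat s S) : S ⊆ boughtSet s :=
  fun _ hu => ((h.mem_iff hu).1 hu).choose

theorem exists_isMoat {v : V} (hv : v ∈ boughtSet s) : ∃ S, I.IsMoat s S ∧ v ∈ S := by
  let c := (I.G.induce (boughtSet s : Set V)).connectedComponentMk ⟨v, hv⟩
  refine ⟨(Subtype.val '' c.supp).toFinset, ⟨c, by simp⟩, ?_⟩
  rw [Set.mem_toFinset]
  exact ⟨⟨v, hv⟩, rfl, rfl⟩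

theorem IsMoat.mem_of_adj (h : I.IsMoat s S) {u v : V} (hu : u ∈ S) (hv : v ∈ boughtSet s)
    (huv : I.G.Adj u v) : v ∈ S := by
  have hadj : (I.G.induce (boughtSet s : Set V)).Adj ⟨u, h.subset hu⟩ ⟨v, hv⟩ := huv
  exact (h.mem_iff hu).2 ⟨h.subset hu, hv, hadj.reachable⟩

theorem IsMoat.disjoint (hS : I.IsMoat s S) (hT : I.IsMoat s T) (hne : S ≠ T) : Disjoint S T := by
  rw [Finset.disjoint_left]
  intro u hu hu'
  apply hne
  ext v
  rw [hS.mem_iff hu, hT.mem_iff hu']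

/-- A walk in $G[F]$ that starts in a moat never leaves it, so the edges inside `S` suffice. -/
theorem IsMoat.induce_preconnected (h : I.IsMoat s S) {H : SimpleGraph V}
    (hH : ∀ u ∈ S, ∀ v ∈ S, I.G.Adj u v → H.Adj u v) : (H.induce (S : Set V)).Preconnected := by
  have key : ∀ a b, (I.G.induce (boughtSet s : Set V)).Walk a b → ∀ ha : a.1 ∈ S,
      ∃ hb : b.1 ∈ S, (H.induce (S : Set V)).Reachable ⟨a.1, ha⟩ ⟨b.1, hb⟩ := by
    intro a b p
    induction p with
    | nil => exact fun ha => ⟨ha, .refl _⟩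
    | @cons a b c hab p ih =>
      intro ha
      have hb : b.1 ∈ S := h.mem_of_adj ha b.2 hab
      obtain ⟨hc, hr⟩ := ih hb
      have hadj : (H.induce (S : Set V)).Adj ⟨a.1, ha⟩ ⟨b.1, hb⟩ := hH _ ha _ hb hab
      exact ⟨hc, hadj.reachable.trans hr⟩
  rintro ⟨u, hu⟩ ⟨v, hv⟩
  obtain ⟨_, _, ⟨p⟩⟩ := (h.mem_iff hu).1 hv
  exact (key _ _ p hu).2

theorem sum_grow (ε : ℝ) (𝕊 : Finset (Finset V)) :
    ∑ S ∈ 𝕊, I.grow s ε S = ∑ S ∈ 𝕊, s.y S + ε * ((𝕊.filter (I.IsActive s)).card : ℝ) := by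
  have : ∀ S, I.grow s ε S = s.y S + if I.IsActive s S then ε else 0 := by
    intro S; unfold grow; split_ifs <;> simp
  simp_rw [this]
  rw [Finset.sum_add_distrib, ← Finset.sum_filter, Finset.sum_const, nsmul_eq_mul, mul_comm]

theorem sum_grow_of_no_active {ε : ℝ} {𝕊 : Finset (Finset V)} (h : ∀ S ∈ 𝕊, ¬ I.IsActive s S) :
    ∑ S ∈ 𝕊, I.grow s ε S = ∑ S ∈ 𝕊, s.y S :=
  Finset.sum_congr rfl fun S hS => if_neg (h S hS)

theorem continuous_grow (S : Finset V) : Continuous fun ε => I.grow s ε S := by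
  unfold grow
  split_ifs <;> fun_prop

theorem familySeparates_union {𝕊 𝕋 : Finset (Finset V)} {p : V × V} :
    FamilySeparates (𝕊 ∪ 𝕋) p ↔ FamilySeparates 𝕊 p ∨ FamilySeparates 𝕋 p := by
  simp only [FamilySeparates, Finset.mem_union, or_and_right, exists_or]

theorem connectedVia_boughtSet_of_no_active (hs : ∀ S, ¬ I.IsActive s S)
    (hterm : ∀ p, I.IsDemand p → p.1 ∈ s.bought ∧ p.2 ∈ s.bought) {p : V × V}
    (hp : I.IsDemand p) (hpm : p ∉ s.marked) : I.ConnectedVia (boughtSet s) p := by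
  obtain ⟨S, hS, hpS⟩ := exists_isMoat (I := I) (mem_boughtSet.2 (hterm p hp).1)
  by_contra hc
  exact hs S ⟨hS, p, hpm, hp, Or.inl ⟨hpS, fun h => hc ((hS.mem_iff hpS).1 h)⟩⟩

end Moats

variable [Fintype V]

/-! #### Weak duality -/

section Duality

theorem mem_boundary {S : Finset V} {v : V} :
    v ∈ I.boundary S ↔ v ∉ S ∧ ∃ u ∈ S, I.G.Adj u v := by
  simp [boundary]

theorem IsMoat.notMem_boundary {s : PCSFState V} {S : Finset V} (h : I.IsMoat s S) {v : V} (hv : v ∈ s.bought) :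
    v ∉ I.boundary S := by
  rw [mem_boundary]
  rintro ⟨hvS, u, hu, huv⟩
  exact hvS (h.mem_of_adj hu (mem_boughtSet.2 hv) huv)

/-- Submodularity: the union separates precisely the pairs separated by one of the families, while a
pair separated by the intersection is separated by both. -/
theorem familyPenalty_union_add_inter_le (𝕊 𝕋 : Finset (Finset V)) :
    I.familyPenalty (𝕊 ∪ 𝕋) + I.familyPenalty (𝕊 ∩ 𝕋) ≤
      I.familyPenalty 𝕊 + I.familyPenalty 𝕋 := by
  unfold familyPenalty
  rw [← Finset.sum_union_inter (s₁ := Finset.univ.filter fun p => FamilySeparates 𝕊 p)]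
  refine add_le_add (le_of_eq ?_) ?_
  · rw [← Finset.filter_or]
    simp_rw [familySeparates_union]
  · refine Finset.sum_le_sum_of_subset_of_nonneg ?_ fun p _ _ => I.pen_nonneg p
    intro p hp
    obtain ⟨S, hS, h⟩ := (Finset.mem_filter.1 hp).2
    rw [Finset.mem_inter] at hS
    exact Finset.mem_inter.2 ⟨Finset.mem_filter.2 ⟨Finset.mem_univ _, S, hS.1, h⟩,
      Finset.mem_filter.2 ⟨Finset.mem_univ _, S, hS.2, h⟩⟩

/-- Uncrossing: the left side of the family constraint is modular, the right side is submodular, and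
the intersection satisfies its constraint. -/
theorem TightFamily.union {y : Finset V → ℝ} (hy : I.DualFeasible y) {𝕊 𝕋 : Finset (Finset V)}
    (h𝕊 : I.TightFamily y 𝕊) (h𝕋 : I.TightFamily y 𝕋) : I.TightFamily y (𝕊 ∪ 𝕋) := by
  refine le_antisymm (hy.family _) ?_
  have h1 := Finset.sum_union_inter (s₁ := 𝕊) (s₂ := 𝕋) (f := y)
  have h2 := hy.family (𝕊 ∩ 𝕋)
  have h3 := familyPenalty_union_add_inter_le (I := I) 𝕊 𝕋
  unfold TightFamily at h𝕊 h𝕋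
  linarith

theorem mem_of_connectedVia_of_disjoint_boundary {F S : Finset V}
    (hS : ∀ v ∈ F, v ∉ I.boundary S) {u v : V} (h : I.ConnectedVia F (u, v)) (hu : u ∈ S) :
    v ∈ S := by
  obtain ⟨_, _, ⟨p⟩⟩ := h
  have key : ∀ a b, (I.G.induce (F : Set V)).Walk a b → a.1 ∈ S → b.1 ∈ S := by
    intro a b p
    induction p with
    | nil => exact id
    | @cons a b c hab p ih =>
      intro ha
      refine ih ?_
      by_contra hb
      exact hS b.1 b.2 (mem_boundary.2 ⟨hb, a.1, ha, hab⟩)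
  exact key _ _ p hu

theorem sum_load_eq (y : Finset V → ℝ) (F : Finset V) :
    ∑ v ∈ F, I.load y v = ∑ S, y S * ((F.filter (· ∈ I.boundary S)).card : ℝ) := by
  unfold load
  simp_rw [Finset.sum_filter]
  rw [Finset.sum_comm]
  refine Finset.sum_congr rfl fun S _ => ?_
  rw [← Finset.sum_filter, Finset.sum_const, nsmul_eq_mul, mul_comm]

theorem DualFeasible.sum_le_cost {y : Finset V → ℝ} (hy : I.DualFeasible y) (F : Finset V) :
    ∑ S, y S ≤ I.cost F := by
  -- Sets whose boundary meets `F` are paid for by the vertex constraints of `F`. For the others, a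
  -- connection inside `F` cannot leave the set, so a demand separated by one of them is not
  -- connected via `F` and the family constraint of `𝕊` applies.
  let 𝕊 : Finset (Finset V) := Finset.univ.filter fun S => ∀ v ∈ F, v ∉ I.boundary S
  rw [← Finset.sum_filter_add_sum_filter_not Finset.univ fun S => ∀ v ∈ F, v ∉ I.boundary S,
    add_comm]
  refine add_le_add ?_ ((hy.family 𝕊).trans ?_)
  · refine le_trans ?_ (Finset.sum_le_sum fun v _ => hy.vertex v)
    rw [sum_load_eq, Finset.sum_filter]
    refine Finset.sum_le_sum fun S _ => ?_
    split_ifs with h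
    · exact mul_nonneg (hy.nonneg S) (Nat.cast_nonneg _)
    · push Not at h
      obtain ⟨v, hv, hvS⟩ := h
      have : 1 ≤ (F.filter (· ∈ I.boundary S)).card :=
        Finset.card_pos.2 ⟨v, Finset.mem_filter.2 ⟨hv, hvS⟩⟩
      have h1 : (1 : ℝ) ≤ ((F.filter (· ∈ I.boundary S)).card : ℝ) := by exact_mod_cast this
      exact le_mul_of_one_le_right (hy.nonneg S) h1
  · unfold familyPenalty unconnected
    rw [Finset.sum_filter, Finset.sum_filter]
    refine Finset.sum_le_sum fun p _ => ?_
    by_cases hd : I.IsDemand p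
    · split_ifs with h1 h2 h2
      · exact le_rfl
      · have hc : I.ConnectedVia F (p.1, p.2) := by
          by_contra hc; exact h2 ⟨hd, hc⟩
        obtain ⟨S, hS, h | h⟩ := h1
        · exact absurd (mem_of_connectedVia_of_disjoint_boundary
            (Finset.mem_filter.1 hS).2 hc h.1) h.2
        · exact absurd (mem_of_connectedVia_of_disjoint_boundary
            (Finset.mem_filter.1 hS).2 hc.symm h.2) h.1
      · exact I.pen_nonneg p
      · exact le_rfl
    · have : I.pen p = 0 := le_antisymm (not_lt.1 hd) (I.pen_nonneg p)
      simp [this]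

theorem DualFeasible.sum_le_opt {y : Finset V → ℝ} (hy : I.DualFeasible y) :
    ∑ S, y S ≤ I.opt :=
  (Finset.le_inf'_iff _ _).2 fun F _ => hy.sum_le_cost F

end Duality

/-! #### Raising the dual variables -/

section Growth

variable {s : PCSFState V}

theorem load_grow_of_bought {ε : ℝ} {v : V} (hv : v ∈ s.bought) :
    I.load (I.grow s ε) v = I.load s.y v :=
  sum_grow_of_no_active fun _ hS h => h.1.notMem_boundary hv (Finset.mem_filter.1 hS).2

theorem load_grow (ε : ℝ) (v : V) : I.load (I.grow s ε) v = I.load s.y v +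
    ε * (((Finset.univ.filter fun S => v ∈ I.boundary S).filter (I.IsActive s)).card : ℝ) :=
  sum_grow ε _

theorem le_of_no_earlier_root {a b c ε : ℝ} (hab : a ≤ b) (hc : 0 ≤ c)
    (h : ∀ ε', 0 ≤ ε' → a + ε' * c = b → ε ≤ ε') : a + ε * c ≤ b := by
  rcases hc.eq_or_lt with rfl | hc
  · simpa using hab
  · have h1 := h ((b - a) / c) (div_nonneg (by linarith) hc.le) (by field_simp; ring)
    rw [le_div_iff₀ hc] at h1
    linarith

/-- The properties of a state that are preserved by every step. -/
structure Invariant (I : PCSF V) (s : PCSFState V) : Prop where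
  nodup : s.bought.Nodup
  zero_mem : ∀ v, I.w v = 0 → v ∈ s.bought
  feasible : I.DualFeasible s.y
  tight : ∀ v ∈ s.bought, I.TightVertex s.y v
  marked : ∃ 𝕋, I.TightFamily s.y 𝕋 ∧ ∀ p, p ∈ s.marked ↔ FamilySeparates 𝕋 p

theorem familyPenalty_nonneg (𝕊 : Finset (Finset V)) : 0 ≤ I.familyPenalty 𝕊 :=
  Finset.sum_nonneg fun p _ => I.pen_nonneg p

theorem IsInitial.invariant (h : I.IsInitial s) : I.Invariant s := by
  obtain ⟨h1, h2, h3, h4⟩ := h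
  have hload : ∀ v, I.load s.y v = 0 := fun v => by simp [load, h4]
  refine ⟨h1, fun v => (h2 v).2, ⟨fun S => by simp [h4], fun v => ?_, fun 𝕊 => ?_⟩,
    fun v hv => ?_, ∅, ?_, fun p => ?_⟩
  · rw [hload]; exact I.w_nonneg v
  · simpa [h4] using familyPenalty_nonneg 𝕊
  · exact (hload v).trans ((h2 v).1 hv).symm
  · simp [TightFamily, familyPenalty, FamilySeparates]
  · simp [h3, FamilySeparates]

/-- Only constraints watched by `vertexTimes` and `familyTimes` can be violated: a bought vertex is
on the boundary of no moat, and a family that separates no unmarked demand has no active member. -/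
theorem Invariant.feasible_grow (h : I.Invariant s) {ε : ℝ} (hε : 0 ≤ ε)
    (hv : ∀ ε' ∈ I.vertexTimes s, ε ≤ ε') (hf : ∀ ε' ∈ I.familyTimes s, ε ≤ ε') :
    I.DualFeasible (I.grow s ε) := by
  refine ⟨fun S => ?_, fun v => ?_, fun 𝕊 => ?_⟩
  · have := h.feasible.nonneg S
    unfold grow; split_ifs <;> linarith
  · by_cases hvb : v ∈ s.bought
    · rw [load_grow_of_bought hvb]; exact h.feasible.vertex v
    · rw [load_grow]
      refine le_of_no_earlier_root (h.feasible.vertex v) (Nat.cast_nonneg _) fun ε' h0 he => ?_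
      exact hv ε' ⟨h0, v, hvb, by rw [TightVertex, load_grow]; exact he⟩
  · by_cases hp : ∃ p, p ∉ s.marked ∧ I.IsDemand p ∧ FamilySeparates 𝕊 p
    · rw [sum_grow]
      refine le_of_no_earlier_root (h.feasible.family 𝕊) (Nat.cast_nonneg _) fun ε' h0 he => ?_
      exact hf ε' ⟨h0, 𝕊, hp, by rw [TightFamily, sum_grow]; exact he⟩
    · rw [sum_grow_of_no_active]
      · exact h.feasible.family 𝕊
      · rintro S hS ⟨_, p, hpm, hpd, hpS⟩
        exact hp ⟨p, hpm, hpd, S, hS, hpS⟩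

theorem tightFamily_grow_of_marked {𝕋 : Finset (Finset V)} (h𝕋 : I.TightFamily s.y 𝕋)
    (hm : ∀ p, p ∈ s.marked ↔ FamilySeparates 𝕋 p) (ε : ℝ) : I.TightFamily (I.grow s ε) 𝕋 := by
  rw [TightFamily, sum_grow_of_no_active]
  · exact h𝕋
  · rintro S hS ⟨_, p, hpm, _, hpS⟩
    exact hpm ((hm p).2 ⟨S, hS, hpS⟩)

theorem Step.invariant {t : PCSFState V} (hst : I.Step s t) (h : I.Invariant s) :
    I.Invariant t := by
  obtain ⟨𝕋, h𝕋, hm⟩ := h.marked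
  cases hst with
  | buy hactive ε v hε₁ hε₂ hv =>
    have hf := h.feasible_grow hε₁.1.1 hε₁.2 hε₂
    refine ⟨List.nodup_cons.2 ⟨hv.1, h.nodup⟩, fun u hu => List.mem_cons_of_mem _ (h.zero_mem u hu),
      hf, fun u hu => ?_, 𝕋, tightFamily_grow_of_marked h𝕋 hm ε, hm⟩
    by_cases hub : u ∈ s.bought
    · exact (load_grow_of_bought hub).trans (h.tight u hub)
    · rcases List.mem_cons.1 hu with rfl | hu
      exacts [hv.2, absurd hu hub]
  | mark hactive ε 𝕊 hε₂ hε₁ h𝕊 =>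
    have hf := h.feasible_grow hε₂.1.1 (fun ε' h' => (hε₁ ε' h').le) hε₂.2
    refine ⟨h.nodup, h.zero_mem, hf, fun u hu =>
      (load_grow_of_bought (s := s) hu).trans (h.tight u hu), 𝕋 ∪ 𝕊, (tightFamily_grow_of_marked h𝕋 hm ε).union hf h𝕊.2, fun p => ?_⟩
    rw [familySeparates_union, Finset.mem_union, hm]
    simp

theorem invariant_of_reflTransGen {t : PCSFState V} (hst : Relation.ReflTransGen I.Step s t)
    (h : I.Invariant s) : I.Invariant t := by
  induction hst with
  | refl => exact h
  | tail _ hab ih => exact hab.invariant ih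

theorem Reaches.invariant (h : I.Reaches s) : I.Invariant s :=
  let ⟨_, h0, hs⟩ := h
  invariant_of_reflTransGen hs h0.invariant

/-! #### Progress and termination -/

theorem isClosed_vertexTimes : IsClosed (I.vertexTimes s) := by
  have : I.vertexTimes s = Set.Ici 0 ∩
      ⋃ v ∈ {v | v ∉ s.bought}, {ε | I.load (I.grow s ε) v = I.w v} := by
    ext ε; simp [vertexTimes, NewTightVertex, TightVertex]
  rw [this]
  refine isClosed_Ici.inter (Set.Finite.isClosed_biUnion (Set.toFinite _) fun v _ => ?_)
  exact isClosed_eq (continuous_finsetSum _ fun S _ => continuous_grow S) continuous_const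

theorem isClosed_familyTimes : IsClosed (I.familyTimes s) := by
  have : I.familyTimes s = Set.Ici 0 ∩
      ⋃ 𝕊 ∈ {𝕊 | ∃ p, p ∉ s.marked ∧ I.IsDemand p ∧ FamilySeparates 𝕊 p},
        {ε | ∑ S ∈ 𝕊, I.grow s ε S = I.familyPenalty 𝕊} := by
    ext ε; simp [familyTimes, NewTightFamily, TightFamily]
  rw [this]
  refine isClosed_Ici.inter (Set.Finite.isClosed_biUnion (Set.toFinite _) fun 𝕊 _ => ?_)
  exact isClosed_eq (continuous_finsetSum _ fun S _ => continuous_grow S) continuous_const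

theorem exists_isLeast_of_isClosed {A : Set ℝ} (hA : IsClosed A) (h0 : ∀ a ∈ A, 0 ≤ a)
    (hne : A.Nonempty) : ∃ a, IsLeast A a :=
  ⟨_, hA.isLeast_csInf hne ⟨0, h0⟩⟩

theorem Invariant.exists_step (h : I.Invariant s) (hact : ∃ S, I.IsActive s S) :
    ∃ t, I.Step s t := by
  obtain ⟨S, hS⟩ := hact
  obtain ⟨p, hpm, hpd, hpS⟩ := hS.2
  -- The family consisting of one active moat becomes tight after a finite raise, so $\varepsilon_2$
  -- is always finite.
  have hne : (I.familyTimes s).Nonempty := by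
    have h1 := h.feasible.family {S}
    rw [Finset.sum_singleton] at h1
    refine ⟨I.familyPenalty {S} - s.y S, sub_nonneg.2 h1, {S},
      ⟨p, hpm, hpd, S, Finset.mem_singleton_self S, hpS⟩, ?_⟩
    rw [TightFamily, Finset.sum_singleton, grow, if_pos hS]
    ring
  obtain ⟨ε₂, hε₂⟩ := exists_isLeast_of_isClosed isClosed_familyTimes (fun a ha => ha.1) hne
  by_cases hv : (I.vertexTimes s).Nonempty
  · obtain ⟨ε₁, hε₁⟩ := exists_isLeast_of_isClosed isClosed_vertexTimes (fun a ha => ha.1) hv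
    rcases le_or_gt ε₁ ε₂ with hle | hlt
    · obtain ⟨v, hv⟩ := hε₁.1.2
      exact ⟨_, Step.buy ⟨S, hS⟩ ε₁ v hε₁ (fun ε' h' => hle.trans (hε₂.2 h')) hv⟩
    · obtain ⟨𝕊, h𝕊⟩ := hε₂.1.2
      exact ⟨_, Step.mark ⟨S, hS⟩ ε₂ 𝕊 hε₂ (fun ε' h' => hlt.trans_le (hε₁.2 h')) h𝕊⟩
  · obtain ⟨𝕊, h𝕊⟩ := hε₂.1.2
    exact ⟨_, Step.mark ⟨S, hS⟩ ε₂ 𝕊 hε₂ (fun ε' h' => absurd ⟨ε', h'⟩ hv) h𝕊⟩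

theorem Step.card_lt {t : PCSFState V} (hst : I.Step s t) :
    (boughtSet s).card + s.marked.card < (boughtSet t).card + t.marked.card := by
  cases hst with
  | buy hactive ε v hε₁ hε₂ hv =>
    have : boughtSet (⟨v :: s.bought, s.marked, I.grow s ε⟩ : PCSFState V) =
        insert v (boughtSet s) := List.toFinset_cons
    rw [this, Finset.card_insert_of_notMem (mem_boughtSet.not.2 hv.1)]
    change _ < _ + s.marked.card
    omega
  | mark hactive ε 𝕊 hε₂ hε₁ h𝕊 =>
    obtain ⟨p, hpm, hpd, hp⟩ := h𝕊.1
    refine Nat.add_lt_add_left (Finset.card_lt_card ?_) _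
    refine (Finset.ssubset_iff_of_subset Finset.subset_union_left).2 ⟨p, ?_, hpm⟩
    exact Finset.mem_union_right _ (Finset.mem_filter.2 ⟨Finset.mem_univ _, hp⟩)

theorem not_exists_infinite_run : ¬ ∃ r : ℕ → PCSFState V, I.IsInitial (r 0) ∧
    ∀ n, I.Step (r n) (r (n + 1)) := by
  rintro ⟨r, -, hr⟩
  have hlow : ∀ n, n ≤ (boughtSet (r n)).card + (r n).marked.card := by
    intro n
    induction n with
    | zero => exact Nat.zero_le _
    | succ n ih => exact Nat.succ_le_of_lt (ih.trans_lt (hr n).card_lt)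
  have h1 := hlow (Fintype.card V + Fintype.card (V × V) + 1)
  have h2 := (boughtSet (r (Fintype.card V + Fintype.card (V × V) + 1))).card_le_univ
  have h3 := (r (Fintype.card V + Fintype.card (V × V) + 1)).marked.card_le_univ
  omega

theorem exists_append_of_reflTransGen {t : PCSFState V}
    (hst : Relation.ReflTransGen I.Step s t) :
    (∃ l, t.bought = l ++ s.bought) ∧ s.marked ⊆ t.marked := by
  induction hst with
  | refl => exact ⟨⟨[], rfl⟩, Finset.Subset.refl _⟩
  | tail _ hab ih =>
    obtain ⟨⟨l, hl⟩, hm⟩ := ih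
    cases hab with
    | buy hactive ε v hε₁ hε₂ hv => exact ⟨⟨v :: l, by simp [hl]⟩, hm⟩
    | mark hactive ε 𝕊 hε₂ hε₁ h𝕊 => exact ⟨⟨l, hl⟩, hm.trans Finset.subset_union_left⟩

end Growth

/-! #### Pruning -/

section Pruning

variable {Q : Finset (V × V)}

theorem pruneVertex_subset (F : Finset V) (v : V) : I.pruneVertex Q F v ⊆ F := by
  unfold pruneVertex
  split_ifs
  exacts [Finset.erase_subset _ _, Finset.Subset.refl _]

theorem foldl_pruneVertex_subset (l : List V) (F : Finset V) : l.foldl (I.pruneVertex Q) F ⊆ F := by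
  induction l generalizing F with
  | nil => exact Finset.Subset.refl _
  | cons v l ih => exact (ih _).trans (pruneVertex_subset F v)

theorem mem_foldl_pruneVertex {l : List V} {F : Finset V} {u : V} (hu : u ∈ F) (hl : u ∉ l) :
    u ∈ l.foldl (I.pruneVertex Q) F := by
  induction l generalizing F with
  | nil => exact hu
  | cons v l ih =>
    rw [List.mem_cons, not_or] at hl
    refine ih ?_ hl.2
    unfold pruneVertex
    split_ifs
    exacts [Finset.mem_erase.2 ⟨hl.1, hu⟩, hu]

theorem connectedVia_foldl_pruneVertex {l : List V} {F : Finset V}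
    (h : ∀ p, I.IsDemand p → p ∉ Q → I.ConnectedVia F p) :
    ∀ p, I.IsDemand p → p ∉ Q → I.ConnectedVia (l.foldl (I.pruneVertex Q) F) p := by
  induction l generalizing F with
  | nil => exact h
  | cons v l ih =>
    refine ih ?_
    unfold pruneVertex
    split_ifs with h'
    exacts [h', h]

/-- The set current at the turn of `x` is the result of the considerations in `l₁`. As `x` survived,
its removal from that set had to disconnect an unmarked demand. -/
theorem exists_not_connectedVia_of_mem_foldl {l₁ l₂ : List V} {F : Finset V} {x : V}
    (hx : x ∈ (l₁ ++ x :: l₂).foldl (I.pruneVertex Q) F) :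
    ∃ p, I.IsDemand p ∧ p ∉ Q ∧
      ¬ I.ConnectedVia ((l₁.foldl (I.pruneVertex Q) F).erase x) p := by
  rw [List.foldl_append, List.foldl_cons] at hx
  have hx := foldl_pruneVertex_subset _ _ hx
  by_contra! h
  rw [pruneVertex, if_pos h] at hx
  exact Finset.notMem_erase _ _ hx

end Pruning

end PCSF

namespace PCSF

open scoped Classical

variable {V : Type*} [Fintype V] {I : PCSF V}

theorem connectedVia_prune (hterm : ∀ p, I.IsDemand p → I.w p.1 = 0 ∧ I.w p.2 = 0)
    {e : PCSFState V} (hi : I.Invariant e) (he : ∀ S, ¬ I.IsActive e S) {p : V × V}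
    (hp : I.IsDemand p) (hpm : p ∉ e.marked) : I.ConnectedVia (I.prune e) p :=
  connectedVia_foldl_pruneVertex (fun _ hp hpm => connectedVia_boughtSet_of_no_active he
    (fun p hp => ⟨hi.zero_mem _ (hterm p hp).1, hi.zero_mem _ (hterm p hp).2⟩) hp hpm) p hp hpm

/-! #### The degree bound for the active moats -/

/-- The number of active moats around each vertex of the pruned set is at most three on average. -/
theorem sum_card_inter_boundary_le (hG : HasSparseSpan I.G.cycleSpace)
    (hterm : ∀ p, I.IsDemand p → I.w p.1 = 0 ∧ I.w p.2 = 0) {s e : PCSFState V}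
    (hse : Relation.ReflTransGen I.Step s e) (hs : I.Invariant s)
    (he : ∀ S, ¬ I.IsActive e S) :
    ∑ S with I.IsActive s S, ((I.prune e).filter (· ∈ I.boundary S)).card ≤
      3 * (Finset.univ.filter (I.IsActive s)).card := by
  have hei := invariant_of_reflTransGen hse hs
  obtain ⟨⟨l, hl⟩, hmarked⟩ := exists_append_of_reflTransGen hse
  let F := boughtSet s
  -- The surviving vertices that were bought after state `s`.
  let X := I.prune e \ F
  let W := F ∪ X
  let H := I.edgesWithin W
  let 𝒜 : Finset (Finset V) := Finset.univ.filter (I.IsActive s)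
  have h𝒜 : ∀ S, S ∈ 𝒜 ↔ I.IsActive s S := fun S => by simp [𝒜]
  have hSF : ∀ S ∈ 𝒜, S ⊆ F := fun S hS => ((h𝒜 S).1 hS).1.subset
  have hconnected : ∀ p, I.IsDemand p → p ∉ e.marked → I.ConnectedVia W p := by
    intro p hp hpm
    refine (connectedVia_prune hterm hei he hp hpm).mono ?_
    intro v hv
    by_cases hvF : v ∈ F
    · exact Finset.mem_union_left _ hvF
    · exact Finset.mem_union_right _ (Finset.mem_sdiff.2 ⟨hv, hvF⟩)
  -- At the turn of `x` no vertex of `F` has been considered yet, and the vertices of `X` survive to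
  -- the end, so the current set contains `W`. A demand that needs `x` there needs it in `W` too.
  have hneeded : ∀ x ∈ X, ∃ p, I.IsDemand p ∧ p ∉ e.marked ∧
      ¬ I.ConnectedVia (W.erase x) p := by
    intro x hx
    obtain ⟨hxe, hxF⟩ := Finset.mem_sdiff.1 hx
    have hxb : x ∈ e.bought := mem_boughtSet.1 (foldl_pruneVertex_subset _ _ hxe)
    have hxl : x ∈ l := by
      rw [hl, List.mem_append] at hxb
      exact hxb.resolve_right fun h => hxF (mem_boughtSet.2 h)
    obtain ⟨l₁, l₂, rfl⟩ := List.append_of_mem hxl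
    have hb : e.bought = l₁ ++ x :: (l₂ ++ s.bought) := by rw [hl]; simp
    have hprune : I.prune e =
        (l₁ ++ x :: (l₂ ++ s.bought)).foldl (I.pruneVertex e.marked) (boughtSet e) := by
      rw [prune, hb]
    obtain ⟨p, hp, hpm, hpc⟩ := exists_not_connectedVia_of_mem_foldl (hprune ▸ hxe)
    refine ⟨p, hp, hpm, fun h => hpc (h.mono (Finset.erase_subset_erase _ ?_))⟩
    intro v hv
    rcases Finset.mem_union.1 hv with hv | hv
    · have hvs : v ∈ s.bought := mem_boughtSet.1 hv
      refine mem_foldl_pruneVertex (mem_boughtSet.2 ?_) fun hvl => ?_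
      · rw [hb]; simp [hvs]
      · have hnd := hei.nodup
        rw [hb] at hnd
        exact (List.nodup_append.1 hnd).2.2 v hvl v (by simp [hvs]) rfl
    · have hv := (Finset.mem_sdiff.1 hv).1
      rw [hprune, List.foldl_append] at hv
      exact foldl_pruneVertex_subset _ _ hv
  -- The demand that needs `x` has both ends in `F`, since they have weight 0. It is unmarked at
  -- `s`, because marks are never removed, and not connected via `F`; so the moats of its ends are
  -- active, and removing `x` separates them.
  have hcut : ∀ x ∈ X, ∃ u v, H.Reachable x u ∧ H.Reachable x v ∧
      ¬ (H.deleteIncidenceSet x).Reachable u v ∧ (∃ S ∈ 𝒜, u ∈ S) ∧ ∃ S ∈ 𝒜, v ∈ S := by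
    intro x hx
    have hxF : x ∉ F := (Finset.mem_sdiff.1 hx).2
    obtain ⟨p, hp, hpm, hpc⟩ := hneeded x hx
    have hpF : p.1 ∈ F ∧ p.2 ∈ F := ⟨mem_boughtSet.2 (hs.zero_mem _ (hterm p hp).1),
      mem_boughtSet.2 (hs.zero_mem _ (hterm p hp).2)⟩
    have hne1 : p.1 ≠ x := fun h => hxF (h ▸ hpF.1)
    have hne2 : p.2 ≠ x := fun h => hxF (h ▸ hpF.2)
    have hsep : ¬ (H.deleteIncidenceSet x).Reachable p.1 p.2 := fun h =>
      hpc (connectedVia_erase_of_reachable (Finset.mem_union_left _ hpF.1) hne1 h)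
    have hconn := (hconnected p hp hpm).reachable_edgesWithin
    have hreach : H.Reachable p.1 x :=
      ((SimpleGraph.reachable_deleteIncidenceSet_or hne1.symm hconn).resolve_left hsep).2
    have hFW : F ⊆ W.erase x := fun v hv =>
      Finset.mem_erase.2 ⟨fun h => hxF (h ▸ hv), Finset.mem_union_left _ hv⟩
    have hpF' : ¬ I.ConnectedVia F p := fun h => hpc (h.mono hFW)
    have hpms : p ∉ s.marked := fun h => hpm (hmarked h)
    refine ⟨p.1, p.2, hreach.symm, hreach.symm.trans hconn, hsep, ?_, ?_⟩
    · obtain ⟨S, hS, hpS⟩ := exists_isMoat (I := I) hpF.1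
      exact ⟨S, (h𝒜 S).2 ⟨hS, p, hpms, hp,
        Or.inl ⟨hpS, fun h => hpF' ((hS.mem_iff hpS).1 h)⟩⟩, hpS⟩
    · obtain ⟨S, hS, hpS⟩ := exists_isMoat (I := I) hpF.2
      exact ⟨S, (h𝒜 S).2 ⟨hS, p, hpms, hp,
        Or.inr ⟨fun h => hpF' ((hS.mem_iff hpS).1 h).symm, hpS⟩⟩, hpS⟩
  have hSX : ∀ S ∈ 𝒜, Disjoint S X := fun S hS =>
    Finset.disjoint_left.2 fun v hv hvX => (Finset.mem_sdiff.1 hvX).2 (hSF S hS hv)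
  have hpre : ∀ S ∈ 𝒜, (H.induce (S : Set V)).Preconnected := fun S hS =>
    ((h𝒜 S).1 hS).1.induce_preconnected fun u hu v hv huv =>
      ⟨huv, Finset.mem_union_left _ (hSF S hS hu), Finset.mem_union_left _ (hSF S hS hv)⟩
  have hcount : ∀ S ∈ 𝒜, ((I.prune e).filter (· ∈ I.boundary S)).card ≤ H.adjCount S X := by
    intro S hS
    refine Finset.card_le_card fun b hb => ?_
    obtain ⟨hbe, hbS⟩ := Finset.mem_filter.1 hb
    have hbX : b ∈ X := Finset.mem_sdiff.2 ⟨hbe, fun h =>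
      ((h𝒜 S).1 hS).1.notMem_boundary (mem_boughtSet.1 h) hbS⟩
    obtain ⟨-, u, hu, hub⟩ := mem_boundary.1 hbS
    exact Finset.mem_filter.2 ⟨hbX, u, hu, hub, Finset.mem_union_left _ (hSF S hS hu),
      Finset.mem_union_right _ hbX⟩
  refine (Finset.sum_le_sum hcount).trans ?_
  rcases X.eq_empty_or_nonempty with hX | ⟨x, hx⟩
  · simp [SimpleGraph.adjCount, hX]
  have hcard : 2 ≤ 𝒜.card + (∅ : Finset V).card := by
    obtain ⟨u, v, -, -, hsep, ⟨S, hS, hu⟩, T, hT, hv⟩ := hcut x hx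
    have hST : S ≠ T := by
      rintro rfl
      exact hsep (SimpleGraph.reachable_deleteIncidenceSet_of_induce (hpre S hS)
        (fun h => Finset.disjoint_left.1 (hSX S hS) h hx) hu hv)
    exact Finset.one_lt_card.2 ⟨S, hS, T, hT, hST⟩
  have key := SimpleGraph.sum_adjCount_add_four_le hG H (fun _ _ h => h.1) 𝒜 ∅ X
    (fun S hS T hT => ((h𝒜 S).1 hS).1.disjoint ((h𝒜 T).1 hT).1)
    (fun S hS => ((h𝒜 S).1 hS).1.nonempty) (by simpa using hSX) (Finset.disjoint_empty_right _)
    hpre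
    (fun x hx => by
      obtain ⟨u, v, hu, hv, hsep, hu', hv'⟩ := hcut x hx
      exact ⟨u, Or.inr hu', v, Or.inr hv', hu, hv, hsep⟩)
    hcard
  -- With `B` empty, each active moat contributes at most $2+1$ to the right side.
  rw [Finset.union_empty, Finset.card_empty] at key
  have h3 : ∑ S ∈ 𝒜, (2 + if H.adjCount S X = 1 then 1 else 0) ≤ 𝒜.card * 3 :=
    Finset.sum_le_card_nsmul _ _ _ fun S _ => by split_ifs <;> omega
  change ∑ S ∈ 𝒜, H.adjCount S X ≤ 3 * 𝒜.card
  omega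

/-! #### The guarantee -/

/-- A raise by `ε` changes the sum by `ε` times the total of $3-k_S$ over the active moats, which is
nonnegative by the average bound. -/
theorem sum_grow_mul_nonneg {s : PCSFState V} {ε : ℝ} (hε : 0 ≤ ε) (k : Finset V → ℕ)
    (hk : ∑ S with I.IsActive s S, k S ≤ 3 * (Finset.univ.filter (I.IsActive s)).card)
    (h : 0 ≤ ∑ S, s.y S * (3 - (k S : ℝ))) : 0 ≤ ∑ S, I.grow s ε S * (3 - (k S : ℝ)) := by
  have h1 : ∀ S, I.grow s ε S * (3 - (k S : ℝ)) =
      s.y S * (3 - (k S : ℝ)) + if I.IsActive s S then ε * (3 - (k S : ℝ)) else 0 := by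
    intro S; unfold grow; split_ifs <;> ring
  simp_rw [h1]
  rw [Finset.sum_add_distrib, ← Finset.sum_filter, ← Finset.mul_sum, Finset.sum_sub_distrib,
    Finset.sum_const, nsmul_eq_mul]
  have h2 : (∑ S with I.IsActive s S, (k S : ℝ)) ≤
      3 * ((Finset.univ.filter (I.IsActive s)).card : ℝ) := by exact_mod_cast hk
  exact add_nonneg h (mul_nonneg hε (by linarith))

/-- The output of the completed run from `e` is fixed in advance, and the degree bound for this same
set is applied at every intermediate state. -/
theorem sum_mul_nonneg_of_run (hG : HasSparseSpan I.G.cycleSpace)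
    (hterm : ∀ p, I.IsDemand p → I.w p.1 = 0 ∧ I.w p.2 = 0) {s₀ s e : PCSFState V}
    (h0 : I.IsInitial s₀) (hs : Relation.ReflTransGen I.Step s₀ s)
    (he : ∀ S, ¬ I.IsActive e S) (hse : Relation.ReflTransGen I.Step s e) :
    0 ≤ ∑ S, s.y S * (3 - (((I.prune e).filter (· ∈ I.boundary S)).card : ℝ)) := by
  induction hs with
  | refl => simp [h0.2.2.2]
  | @tail a b hsa hab ih =>
    have hae := Relation.ReflTransGen.head hab hse
    have hk := sum_card_inter_boundary_le hG hterm hae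
      (invariant_of_reflTransGen hsa h0.invariant) he
    cases hab with
    | buy hactive ε v hε₁ hε₂ hv => exact sum_grow_mul_nonneg hε₁.1.1 _ hk (ih hae)
    | mark hactive ε 𝕊 hε₂ hε₁ h𝕊 => exact sum_grow_mul_nonneg hε₂.1.1 _ hk (ih hae)

theorem sum_weight_prune_le (hG : HasSparseSpan I.G.cycleSpace)
    (hterm : ∀ p, I.IsDemand p → I.w p.1 = 0 ∧ I.w p.2 = 0) {e : PCSFState V}
    (hr : I.Reaches e) (he : ∀ S, ¬ I.IsActive e S) :
    ∑ v ∈ I.prune e, I.w v ≤ 3 * ∑ S, e.y S := by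
  obtain ⟨s₀, h0, hs⟩ := hr
  have h1 := sum_mul_nonneg_of_run hG hterm h0 hs he .refl
  have h2 : ∑ v ∈ I.prune e, I.w v = ∑ v ∈ I.prune e, I.load e.y v :=
    Finset.sum_congr rfl fun v hv => ((invariant_of_reflTransGen hs h0.invariant).tight v
      (mem_boughtSet.1 (foldl_pruneVertex_subset _ _ hv))).symm
  rw [h2, sum_load_eq]
  simp_rw [mul_sub] at h1
  rw [Finset.sum_sub_distrib, ← Finset.sum_mul] at h1
  linarith

/-- Pruning keeps every unmarked demand connected, so the unconnected demands are marked and hence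
separated by the one tight family `𝕋` that accounts for all marks. -/
theorem sum_penalty_unconnected_prune_le
    (hterm : ∀ p, I.IsDemand p → I.w p.1 = 0 ∧ I.w p.2 = 0) {e : PCSFState V}
    (hi : I.Invariant e) (he : ∀ S, ¬ I.IsActive e S) :
    ∑ p ∈ I.unconnected (I.prune e), I.pen p ≤ ∑ S, e.y S := by
  obtain ⟨𝕋, h𝕋, hm⟩ := hi.marked
  calc ∑ p ∈ I.unconnected (I.prune e), I.pen p
      ≤ I.familyPenalty 𝕋 := by
        refine Finset.sum_le_sum_of_subset_of_nonneg (fun p hp => ?_) fun p _ _ => I.pen_nonneg p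
        obtain ⟨-, hd, hc⟩ := Finset.mem_filter.1 hp
        refine Finset.mem_filter.2 ⟨Finset.mem_univ _, (hm p).1 ?_⟩
        by_contra hpm
        exact hc (connectedVia_prune hterm hi he hd hpm)
    _ = ∑ S ∈ 𝕋, e.y S := h𝕋.symm
    _ ≤ ∑ S, e.y S := Finset.sum_le_sum_of_subset_of_nonneg (Finset.subset_univ _)
        fun S _ _ => hi.feasible.nonneg S

end PCSF

theorem theorem2 {V : Type*} [Fintype V] (I : PCSF V)
    (hplanar : IsPlanarGraph I.G)
    (hterminal : ∀ i j : V, 0 < I.pen (i, j) → I.w i = 0 ∧ I.w j = 0) :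
    -- the algorithm never gets stuck and always terminates
    (∀ s : PCSFState V, I.Reaches s → (∃ S, I.IsActive s S) → ∃ t, I.Step s t) ∧
    (¬ ∃ r : ℕ → PCSFState V, I.IsInitial (r 0) ∧ ∀ n, I.Step (r n) (r (n + 1))) ∧
    -- every output satisfies the guarantee
    ∀ (F' : Finset V) (Q' : Finset (V × V)) (y : Finset V → ℝ), I.Outputs F' Q' y →
      I.DualFeasible y ∧
      ∑ p ∈ Q', I.pen p ≤ ∑ S : Finset V, y S ∧
      ∑ v ∈ F', I.w v ≤ 3 * ∑ S : Finset V, y S ∧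
      ∑ v ∈ F', I.w v + ∑ p ∈ Q', I.pen p ≤ 4 * ∑ S : Finset V, y S ∧
      4 * ∑ S : Finset V, y S ≤ 4 * I.opt := by
  have hG := hasSparseSpan_cycleSpace_of_isPlanarGraph I.G hplanar
  have hterm : ∀ p, I.IsDemand p → I.w p.1 = 0 ∧ I.w p.2 = 0 := fun p hp => hterminal p.1 p.2 hp
  refine ⟨fun s hs hact => hs.invariant.exists_step hact, PCSF.not_exists_infinite_run, ?_⟩
  rintro F' Q' y ⟨e, hr, he, rfl, rfl, rfl⟩
  have hi := hr.invariant
  have h1 := PCSF.sum_penalty_unconnected_prune_le hterm hi he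
  have h2 := PCSF.sum_weight_prune_le hG hterm hr he
  have h3 := hi.feasible.sum_le_opt
  exact ⟨hi.feasible, h1, h2, by linarith, by linarith⟩
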